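/- Let $(X,\mu)$ be a Lebesgue space with continuous probability measure; all notions are understood mod 0. A locally finite filtration $\tau=\{\xi_n\}_{n\ge 0}$ is a decreasing sequence of measurable partitions of $X$, with $\xi_0$ the partition into singletons, such that for each $n$ almost all blocks of $\xi_n$ are finite and only finitely many types of conditional measures occur. Two filtrations are isomorphic if an isomorphism of the measure spaces takes the $n$th partition of the first to the $n$th partition of the second for every $n$. A block $C$ of $\xi_n$ with its conditional measure $\mu^C$ is a measured tree: its leaves are the points of $C$, and its vertices of level $k$ are the blocks of $\xi_k$ contained in $C$, $k\le n$. Let $\delta_n$ be the partition of $X/\xi_n$ into classes of blocks that are isomorphic as measured trees. For a semimetric $\rho$ on $X$ put $d^n_\rho(C_1,C_2)=\min_\psi\sum_{x\in C_1,\,y\in C_2}\rho(x,y)\psi(x,y)$, where $\psi$ runs over the couplings of $\mu^{C_1}$ and $\mu^{C_2}$ that are couplings of measured trees, i.e. for all vertices $a\subset C_1$, $b\subset C_2$ of the same level with $\psi(a\times b)>0$, the normalized restriction of $\psi$ to $a\times b$ has as marginals the conditional measures on $a$ and on $b$. Say that $\tau$ satisfies the standardness criterion for a class of semimetrics $\rho$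 if for every $\rho$ in the class and every $\varepsilon>0$ there is $N$ such that for every $n>N$ there is a measurable set $D\subset X/\xi_n$ with $\mu_{\xi_n}(D)>1-\varepsilon$ and $$\sup\{d^n_\rho(C_1,C_2):\ C_1,C_2\in D \text{ in the same element of }\delta_n\}<\varepsilon.$$ Consider each of the following classes: (a) $\rho(x,y)=|f(x)-f(y)|$ with $f$ bounded and measurable; (b) integrable admissible metrics (metrics on a set of full measure that are measurable as functions of two variables, separable, and $\mu\times\mu$-integrable); (c) cut semimetrics of finite measurable partitions ($\rho(x,y)=1$ if $x,y$ lie in different elements of the partition, and $0$ otherwise). An equipped graded multigraph (with a single root at level $0$, finite levels, finitely many edges between consecutive levels, every vertex having a successor and every vertex except the root a predecessor) carries positive cotransition probabilities on its edges, which sum to $1$ over the edges coming to any given non-root vertex from the previous level; the paths from the root to a vertex $v$, weighted by the products of the cotransition probabilities, form a measured tree with root $v$. The multigraph is minimal if distinct vertices of the same level have nonisomorphic measured trees. A minimal filtration is the tail filtration on the space of infinite paths of a minimal equipped multigraph with a probability measure that agrees with the equipment (the conditional probabilities of the initial edges given the tail of a path are the cotransition probabilities). A filtration is standard if it is locally finite,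 ergodic and isomorphic to a minimal filtration. **Proposition 5.** For each of the classes (a), (b), (c): 1) a locally finite filtration isomorphic to a locally finite filtration satisfying the standardness criterion also satisfies this criterion; 2) every minimal filtration satisfies the standardness criterion; hence every standard filtration satisfies the standardness criterion (the "only if" part of the general standardness criterion). -/

import Mathlib

open MeasureTheory ProbabilityTheory

noncomputable section

namespace Filtrations

/-! ## Measurable partitions, conditional measures, filtrations

A Lebesgue space is modelled by a standard Borel space with a Borel probability measure, a
partition by the equivalence relation whose classes are its blocks, and a filtration by a
sequence of partitions `ξ 0, ξ 1, …`, decreasing in the sense that the blocks grow. -/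

/-- The σ-algebra of a partition: the measurable sets that are unions of blocks. -/
@[reducible] def partitionSigma {X : Type*} [MeasurableSpace X] (s : Setoid X) : MeasurableSpace X where
  MeasurableSet' A := MeasurableSet A ∧ ∀ x y, s x y → (x ∈ A ↔ y ∈ A)
  measurableSet_empty := ⟨MeasurableSet.empty, fun _ _ _ => Iff.rfl⟩
  measurableSet_compl A hA := ⟨hA.1.compl, fun x y h => not_congr (hA.2 x y h)⟩
  measurableSet_iUnion f hf := ⟨MeasurableSet.iUnion fun i => (hf i).1, fun x y h => by
    simp only [Set.mem_iUnion]
    exact exists_congr fun i => (hf i).2 x y h⟩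

/-- The conditional measure `μ^C` on the block `C` of `x`. -/
def condMeasure {X : Type*} [MeasurableSpace X] [StandardBorelSpace X]
    (μ : Measure X) [IsFiniteMeasure μ] (s : Setoid X) (x : X) : Measure X :=
  condExpKernel μ (partitionSigma s) x

/-- The points of the block of `x` that have positive conditional measure. Mod 0, a block with
an atomic conditional measure consists of these points. -/
def atoms {X : Type*} [MeasurableSpace X] [StandardBorelSpace X]
    (μ : Measure X) [IsFiniteMeasure μ] (s : Setoid X) (x : X) : Set X :=
  {y | s x y ∧ condMeasure μ s x {y} ≠ 0}

/-- A locally finite filtration: a decreasing (mod 0) sequence of measurable partitions that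
starts from the partition into singletons (mod 0), such that almost all blocks of each partition
are finite (mod 0) and there are only finitely many types of conditional measures (mod 0). -/
structure IsLocallyFiniteFiltration {X : Type*} [MeasurableSpace X] [StandardBorelSpace X]
    (μ : Measure X) [IsFiniteMeasure μ] (ξ : ℕ → Setoid X) : Prop where
  measurable_partition : ∀ n, ∃ f : X → ℝ, Measurable f ∧ ξ n = Setoid.ker f
  zero : ∃ S : Set X, (∀ᵐ x ∂μ, x ∈ S) ∧ ∀ x ∈ S, ∀ y ∈ S, ξ 0 x y → x = y
  decreasing : ∀ n, ∃ S : Set X, (∀ᵐ x ∂μ, x ∈ S) ∧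
    ∀ x ∈ S, ∀ y ∈ S, ξ n x y → ξ (n + 1) x y
  finite_blocks : ∀ n, ∀ᵐ x ∂μ,
    (atoms μ (ξ n) x).Finite ∧ condMeasure μ (ξ n) x (atoms μ (ξ n) x)ᶜ = 0
  finite_types : ∀ n, ∃ T : Set X, T.Finite ∧ ∀ᵐ x ∂μ, ∃ t ∈ T,
    ∃ e : atoms μ (ξ n) x ≃ atoms μ (ξ n) t,
      ∀ u : atoms μ (ξ n) x, condMeasure μ (ξ n) x {u.1} = condMeasure μ (ξ n) t {(e u).1}

/-- Ergodicity: the intersection of the σ-algebras of the partitions is trivial. -/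
def IsErgodic {X : Type*} [MeasurableSpace X] (μ : Measure X) (ξ : ℕ → Setoid X) : Prop :=
  ∀ A : Set X, (∀ n, MeasurableSet[partitionSigma (ξ n)] A) → μ A = 0 ∨ μ A = 1

/-- Isomorphism of filtrations: an isomorphism mod 0 of measure spaces that takes, mod 0, each
partition of the first filtration to the corresponding partition of the second. -/
def IsomorphicFiltrations {X Y : Type*} [MeasurableSpace X] [MeasurableSpace Y]
    (μ : Measure X) (ξ : ℕ → Setoid X) (ν : Measure Y) (ζ : ℕ → Setoid Y) : Prop :=
  ∃ (φ : X → Y) (θ : Y → X), MeasurePreserving φ μ ν ∧ MeasurePreserving θ ν μ ∧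
    (∀ᵐ x ∂μ, θ (φ x) = x) ∧ (∀ᵐ y ∂ν, φ (θ y) = y) ∧
    ∃ S : Set X, (∀ᵐ x ∂μ, x ∈ S) ∧
      ∀ x ∈ S, ∀ x' ∈ S, ∀ n, ξ n x x' ↔ ζ n (φ x) (φ x')

/-! ## Blocks as measured trees

The block of `x` in `ξ n` carries the hierarchy of the partitions `ξ 0, …, ξ (n - 1)`: it is a
tree of rank `n` whose leaves are the points of the block, weighted by the conditional measure. -/

/-- The blocks of `x` and `y` in `ξ n` are isomorphic as measured trees, that is, they lie in the
same element of the partition `δ_n` of the space of blocks into types. -/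
def SameType {X : Type*} [MeasurableSpace X] [StandardBorelSpace X]
    (μ : Measure X) [IsFiniteMeasure μ] (ξ : ℕ → Setoid X) (n : ℕ) (x y : X) : Prop :=
  ∃ e : atoms μ (ξ n) x ≃ atoms μ (ξ n) y,
    (∀ u : atoms μ (ξ n) x, condMeasure μ (ξ n) x {u.1} = condMeasure μ (ξ n) y {(e u).1}) ∧
    ∀ k < n, ∀ u v : atoms μ (ξ n) x, ξ k u.1 v.1 ↔ ξ k (e u).1 (e v).1

/-- A coupling of the blocks of `x` and `y` in `ξ n` as measured trees: a coupling `ψ` of the two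
conditional measures such that both coordinate projections are projections of measured trees.
That is, if `a` and `b` are vertices of the same level `k` of the two trees and `ψ (a × b) > 0`,
then the two marginals of the normalized restriction of `ψ` to `a × b` are the conditional
measures on `a` and on `b`. -/
structure IsTreeCoupling {X : Type*} [MeasurableSpace X] [StandardBorelSpace X]
    (μ : Measure X) [IsFiniteMeasure μ] (ξ : ℕ → Setoid X) (n : ℕ) (x y : X)
    (ψ : Measure (X × X)) : Prop where
  map_fst : ψ.map Prod.fst = condMeasure μ (ξ n) x
  map_snd : ψ.map Prod.snd = condMeasure μ (ξ n) y
  tree_fst : ∀ k < n, ∀ u v : X,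
    ψ ({u} ×ˢ {v' | ξ k v v'}) * condMeasure μ (ξ n) x {u' | ξ k u u'} =
      condMeasure μ (ξ n) x {u} * ψ ({u' | ξ k u u'} ×ˢ {v' | ξ k v v'})
  tree_snd : ∀ k < n, ∀ u v : X,
    ψ ({u' | ξ k u u'} ×ˢ {v}) * condMeasure μ (ξ n) y {v' | ξ k v v'} =
      condMeasure μ (ξ n) y {v} * ψ ({u' | ξ k u u'} ×ˢ {v' | ξ k v v'})

/-- The distance `d^n_ρ` between the blocks of `x` and `y` in `ξ n`: the least cost, with respect
to the semimetric `ρ`, of a coupling of these blocks as measured trees. -/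
def treeDist {X : Type*} [MeasurableSpace X] [StandardBorelSpace X]
    (μ : Measure X) [IsFiniteMeasure μ] (ξ : ℕ → Setoid X) (ρ : X → X → ℝ) (n : ℕ)
    (x y : X) : ENNReal :=
  ⨅ (ψ : Measure (X × X)) (_ : IsTreeCoupling μ ξ n x y ψ),
    ∫⁻ p, ENNReal.ofReal (ρ p.1 p.2) ∂ψ

/-! ## The standardness criterion -/

/-- An admissible metric: a metric, defined on a set of full measure, that is measurable as a
function of two variables and separable; it is moreover required to be integrable. -/
structure IsAdmissibleMetric {X : Type*} [MeasurableSpace X] (μ : Measure X)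
    (ρ : X → X → ℝ) : Prop where
  integrable : Integrable (fun p : X × X => ρ p.1 p.2) (μ.prod μ)
  metric : ∃ S : Set X, (∀ᵐ x ∂μ, x ∈ S) ∧
    (∀ x ∈ S, ∀ y ∈ S, ρ x y = 0 ↔ x = y) ∧
    (∀ x ∈ S, ∀ y ∈ S, ρ x y = ρ y x) ∧
    (∀ x ∈ S, ∀ y ∈ S, ∀ z ∈ S, ρ x z ≤ ρ x y + ρ y z) ∧
    ∃ Q ⊆ S, Q.Countable ∧ ∀ x ∈ S, ∀ ε > 0, ∃ q ∈ Q, ρ x q < ε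

/-- The three classes of test objects in the standardness criterion: bounded measurable functions,
admissible metrics, cut semimetrics of finite partitions. -/
inductive TestKind
  | function
  | metric
  | cut

/-- The semimetrics of each of the three classes; to a function `f` there corresponds the
semimetric `|f x - f y|`. -/
def IsTest {X : Type*} [MeasurableSpace X] (μ : Measure X) : TestKind → (X → X → ℝ) → Prop
  | .function, ρ => ∃ f : X → ℝ, MemLp f ⊤ μ ∧ ρ = fun x y => |f x - f y|
  | .metric, ρ => IsAdmissibleMetric μ ρ
  | .cut, ρ => ∃ (m : ℕ) (c : X → Fin m), AEMeasurable c μ ∧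
      ρ = fun x y => if c x = c y then 0 else 1

/-- The condition of the criterion for one semimetric `ρ`: for every `ε > 0` and all large `n`
there is a measurable set `D` of blocks of `ξ n`, of measure greater than `1 - ε` in the quotient
space, such that the supremum of the distances between two blocks of the same type that lie
in `D` is less than `ε`. -/
def CollapsesWithinTypes {X : Type*} [MeasurableSpace X] [StandardBorelSpace X]
    (μ : Measure X) [IsFiniteMeasure μ] (ξ : ℕ → Setoid X) (ρ : X → X → ℝ) : Prop :=
  ∀ ε : ℝ, 0 < ε → ∃ N : ℕ, ∀ n > N, ∃ D : Set (Quotient (ξ n)),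
    NullMeasurableSet (Quotient.mk (ξ n) ⁻¹' D) μ ∧
    1 - ε < μ.real (Quotient.mk (ξ n) ⁻¹' D) ∧
    ∃ η < ε, ∀ x y : X, Quotient.mk (ξ n) x ∈ D → Quotient.mk (ξ n) y ∈ D →
      SameType μ ξ n x y → treeDist μ ξ ρ n x y ≤ ENNReal.ofReal η

/-- The standardness criterion, in the form that uses test objects of the class `t`. -/
def StandardnessCriterion {X : Type*} [MeasurableSpace X] [StandardBorelSpace X]
    (t : TestKind) (μ : Measure X) [IsFiniteMeasure μ] (ξ : ℕ → Setoid X) : Prop :=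
  ∀ ρ : X → X → ℝ, IsTest μ t ρ → CollapsesWithinTypes μ ξ ρ

/-! ## Equipped graded multigraphs and minimal filtrations -/

/-- An equipped graded multigraph with finite levels and finitely many edges between consecutive
levels. An edge `e` goes from the vertex `src e` to the vertex `tgt e` of the next level, and
`cotrans e` is its cotransition probability. -/
structure EquippedMultigraph where
  V : Type
  E : Type
  level : V → ℕ
  src : E → V
  tgt : E → V
  root : V
  cotrans : E → ℝ
  level_tgt : ∀ e, level (tgt e) = level (src e) + 1
  level_eq_zero : ∀ v, level v = 0 ↔ v = root
  finite_level : ∀ n, {v | level v = n}.Finite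
  finite_edges : ∀ v, {e | tgt e = v}.Finite
  exists_succ : ∀ v, ∃ e, src e = v
  exists_pred : ∀ v, v ≠ root → ∃ e, tgt e = v
  cotrans_pos : ∀ e, 0 < cotrans e
  cotrans_sum : ∀ v, v ≠ root → ∑ᶠ e ∈ {e | tgt e = v}, cotrans e = 1

namespace EquippedMultigraph

/-- The list of edges `p`, read from the top down, is a path from the root to `v`. -/
def IsPathTo (Γ : EquippedMultigraph) : Γ.V → List Γ.E → Prop
  | v, [] => v = Γ.root
  | v, e :: p => Γ.tgt e = v ∧ IsPathTo Γ (Γ.src e) p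

/-- The measure of a finite path: the product of its cotransition probabilities. -/
def weight (Γ : EquippedMultigraph) (p : List Γ.E) : ℝ := (p.map Γ.cotrans).prod

/-- The trees of the paths from the root to `u` and to `v` are isomorphic as measured trees. The
leaves of the tree of `v` are these paths, and the vertices at distance `j` from the root of the
tree are the classes of paths that have the same top `j` edges. -/
def TreeIso (Γ : EquippedMultigraph) (u v : Γ.V) : Prop :=
  ∃ e : {p : List Γ.E // Γ.IsPathTo u p} ≃ {p : List Γ.E // Γ.IsPathTo v p},
    (∀ p : {p : List Γ.E // Γ.IsPathTo u p}, Γ.weight p.1 = Γ.weight (e p).1) ∧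
    ∀ (j : ℕ) (p q : {p : List Γ.E // Γ.IsPathTo u p}),
      p.1.take j = q.1.take j ↔ (e p).1.take j = (e q).1.take j

/-- A minimal multigraph: distinct vertices of the same level have nonisomorphic measured trees. -/
def IsMinimal (Γ : EquippedMultigraph) : Prop :=
  ∀ u v, Γ.level u = Γ.level v → Γ.TreeIso u v → u = v

/-- The space of infinite paths that start at the root; `ω n` is the edge of the path `ω` that
goes from level `n` to level `n + 1`. -/
def PathSpace (Γ : EquippedMultigraph) : Type :=
  {ω : ℕ → Γ.E // Γ.src (ω 0) = Γ.root ∧ ∀ n, Γ.tgt (ω n) = Γ.src (ω (n + 1))}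

/-- The set of edges is discrete. -/
instance (Γ : EquippedMultigraph) : MeasurableSpace Γ.E := ⊤

instance (Γ : EquippedMultigraph) : DiscreteMeasurableSpace Γ.E := ⟨fun _ => trivial⟩

/-- The Borel structure of the path space, generated by the cylinder sets. -/
instance (Γ : EquippedMultigraph) : MeasurableSpace Γ.PathSpace :=
  inferInstanceAs (MeasurableSpace {_ω : ℕ → Γ.E // _})

instance (Γ : EquippedMultigraph) : Countable Γ.E := by
  rw [← Set.countable_univ_iff]
  have h : (Set.univ : Set Γ.E) =
      ⋃ n : ℕ, ⋃ v ∈ {v | Γ.level v = n}, {e | Γ.tgt e = v} := by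
    ext e
    simp
  rw [h]
  exact Set.countable_iUnion fun n =>
    (Γ.finite_level n).countable.biUnion fun v _ => (Γ.finite_edges v).countable

instance (Γ : EquippedMultigraph) : StandardBorelSpace Γ.PathSpace := by
  have h : MeasurableSet {ω : ℕ → Γ.E |
      Γ.src (ω 0) = Γ.root ∧ ∀ n, Γ.tgt (ω n) = Γ.src (ω (n + 1))} := by
    have h0 : MeasurableSet {ω : ℕ → Γ.E | Γ.src (ω 0) = Γ.root} :=
      (MeasurableSet.of_discrete : MeasurableSet {e | Γ.src e = Γ.root}).preimage
        (measurable_pi_apply 0)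
    have h1 : ∀ n, MeasurableSet {ω : ℕ → Γ.E | Γ.tgt (ω n) = Γ.src (ω (n + 1))} := fun n =>
      ((measurable_pi_apply n).prodMk (measurable_pi_apply (n + 1)) :
        Measurable fun ω : ℕ → Γ.E => (ω n, ω (n + 1)))
        (MeasurableSet.of_discrete : MeasurableSet {p : Γ.E × Γ.E | Γ.tgt p.1 = Γ.src p.2})
    have h2 := h0.inter (MeasurableSet.iInter h1)
    convert h2 using 1
    ext ω
    simp
  exact h.standardBorel

/-- The tail filtration: two paths lie in the same block of the `n`th partition if they coincide
from level `n` on. -/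
def tail (Γ : EquippedMultigraph) (n : ℕ) : Setoid Γ.PathSpace where
  r ω ω' := ∀ i, n ≤ i → ω.1 i = ω'.1 i
  iseqv := ⟨fun _ _ _ => rfl, fun h i hi => (h i hi).symm,
    fun h h' i hi => (h i hi).trans (h' i hi)⟩

/-- A measure on the path space agrees with the equipment: given the path from level `n + 1` on,
the conditional probability that the preceding edge is `e` equals `cotrans e` if `e` ends at the
vertex of the path at level `n + 1`, and `0` otherwise. -/
def Agrees (Γ : EquippedMultigraph) (μ : Measure Γ.PathSpace) : Prop :=
  ∀ (n : ℕ) (e : Γ.E) (B : Set Γ.PathSpace), MeasurableSet[partitionSigma (Γ.tail (n + 1))] B →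
    μ ({ω | ω.1 n = e} ∩ B) =
      ENNReal.ofReal (Γ.cotrans e) * μ ({ω | Γ.src (ω.1 (n + 1)) = Γ.tgt e} ∩ B)

end EquippedMultigraph

/-- A standard filtration: a locally finite ergodic filtration that is isomorphic to a minimal
filtration, that is, to the tail filtration of the path space of a minimal multigraph with a
measure that agrees with the equipment. -/
def IsStandard {X : Type*} [MeasurableSpace X] [StandardBorelSpace X]
    (μ : Measure X) [IsFiniteMeasure μ] (ξ : ℕ → Setoid X) : Prop :=
  IsLocallyFiniteFiltration μ ξ ∧ IsErgodic μ ξ ∧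
    ∃ (Γ : EquippedMultigraph) (ν : Measure Γ.PathSpace), IsProbabilityMeasure ν ∧
      Γ.IsMinimal ∧ Γ.Agrees ν ∧ IsomorphicFiltrations μ ξ ν Γ.tail

end Filtrations

end

noncomputable section

namespace Filtrations

open Filter Set
open scoped ENNReal Topology

/-! ### Conditional measures of a measurable partition -/

section Conditional

variable {X : Type*} [MeasurableSpace X]

/-! Invariance. Conditional measures are determined mod 0 by integral identities over saturated
sets, so an isomorphism carries almost every conditional measure of one filtration to that of the
other (`ae_condMeasure_eq_map`). Over such blocks it is an isomorphism of measured trees and pushes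
tree couplings forward to tree couplings. Test semimetrics pull back to tests of the same class
(`IsTest.comp`), so the good set of blocks and the bound transfer.

Minimal filtrations. Agreement with the equipment makes almost every block of `tail n` a copy of the
measured tree of its vertex of level `n`. By minimality, two such blocks of the same type have the
same vertex (`IsMinimal.vertex_eq_of_sameType`), and joining the paths with equal first `n` edges is
a tree coupling (`IsRegularPath.treeDist_le`). It remains to show that a test semimetric is small in
the mean on such pairs.

All three kinds of tests are separable semimetrics on a set of full measure, with integrable
distance functions. Hence finitely many points `q i` lie close, in the mean, to a random path, and
by Lévy's upward theorem the functions `ρ x (q i)` are close in L¹ to their conditional expectations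
given the first `N` edges. The index with the least predicted distance depends on these edges alone,
so paths that share them are close to a common `q j`: `ρ x y ≤ h x + h y` with a small integral of
`h` (`exists_bound_of_eq_initial`). Averaging `h` over blocks preserves its integral, and Markov's
inequality discards the few blocks with a large average.

For standard filtrations the two parts are combined. -/

theorem partitionSigma_le (s : Setoid X) : partitionSigma s ≤ ‹MeasurableSpace X› :=
  fun _ hA => hA.1

/-- A function that is measurable for the σ-algebra of a partition is constant on its blocks. -/
theorem eq_of_measurable_partitionSigma {Z : Type*} [MeasurableSpace Z]
    [MeasurableSingletonClass Z] {s : Setoid X} {g : X → Z} (hg : Measurable[partitionSigma s] g)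
    {x y : X} (h : s x y) : g x = g y :=
  ((hg (measurableSet_singleton (g y))).2 x y h).2 rfl

theorem measurable_partitionSigma_iff {Z : Type*} [MeasurableSpace Z]
    {s : Setoid X} {g : X → Z} (hg : Measurable g) (h : ∀ x y, s x y → g x = g y) :
    Measurable[partitionSigma s] g :=
  fun A hA => ⟨hg hA, fun x y hxy => by simp only [mem_preimage, h x y hxy]⟩

variable [StandardBorelSpace X] (μ : Measure X) [IsFiniteMeasure μ] (s : Setoid X)

instance (x : X) : IsProbabilityMeasure (condMeasure μ s x) := by
  unfold condMeasure; infer_instance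

theorem measurable_condMeasure_apply {A : Set X} (hA : MeasurableSet A) :
    Measurable[partitionSigma s] fun x => condMeasure μ s x A :=
  measurable_condExpKernel hA

theorem measurable_condMeasure : Measurable[partitionSigma s] (condMeasure μ s) :=
  (condExpKernel μ (partitionSigma s)).measurable

variable {s} in
theorem condMeasure_congr {x y : X} (h : s x y) : condMeasure μ s x = condMeasure μ s y :=
  Measure.ext fun _ hA => eq_of_measurable_partitionSigma (measurable_condMeasure_apply μ s hA) h

variable {s} in
theorem atoms_congr {x y : X} (h : s x y) : atoms μ s x = atoms μ s y := by
  ext z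
  simp only [atoms, mem_ofPred_eq, condMeasure_congr μ h]
  exact and_congr_left fun _ => ⟨fun hz => s.trans (s.symm h) hz, fun hz => s.trans h hz⟩

/-- The image of `μ` under the diagonal disintegrates over the σ-algebra of the partition into the
conditional measures; both expressions are evaluated on `V ×ˢ A`. -/
theorem setLIntegral_condMeasure {V A : Set X} (hV : MeasurableSet[partitionSigma s] V)
    (hA : MeasurableSet A) : ∫⁻ x in V, condMeasure μ s x A ∂μ = μ (A ∩ V) := by
  have hm := partitionSigma_le s
  have h1 : (μ.trim hm ⊗ₘ condExpKernel μ (partitionSigma s)) (V ×ˢ A) = μ (A ∩ V) := by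
    rw [compProd_trim_condExpKernel hm]
    have hd : @Measurable X (X × X) _ ((partitionSigma s).prod _) Function.diag :=
      (measurable_id'' hm).prodMk measurable_id
    rw [@Measure.map_apply X (X × X) _ ((partitionSigma s).prod _) μ _
      hd (V ×ˢ A) (hV.prod hA)]
    congr 1
    ext x
    simp [and_comm]
  rw [Measure.compProd_apply_prod hV hA, restrict_trim hm μ hV,
    lintegral_trim hm (measurable_condExpKernel hA)] at h1
  exact h1

/-- Uniqueness of conditional measures, used to identify them both under an isomorphism and on a
path space. -/
theorem condMeasure_apply_ae_eq {A : Set X} (hA : MeasurableSet A) {g : X → ℝ≥0∞}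
    (hg : Measurable[partitionSigma s] g)
    (h : ∀ V, MeasurableSet[partitionSigma s] V → ∫⁻ x in V, g x ∂μ = μ (A ∩ V)) :
    ∀ᵐ x ∂μ, condMeasure μ s x A = g x := by
  have hm := partitionSigma_le s
  refine ae_of_ae_trim hm (ae_eq_of_forall_setLIntegral_eq_of_sigmaFinite
    (measurable_condMeasure_apply μ s hA) hg fun V hV _ => ?_)
  rw [restrict_trim hm μ hV, lintegral_trim hm (measurable_condMeasure_apply μ s hA),
    lintegral_trim hm hg, setLIntegral_condMeasure μ s hV hA, h V hV]

/-- Two families of probability measures that agree a.e. on each measurable set agree a.e. -/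
theorem ae_eq_of_forall_apply_ae_eq {Y Z : Type*} [MeasurableSpace Y] {ν : Measure Y}
    [MeasurableSpace Z] [MeasurableSpace.CountablyGenerated Z]
    {κ η : Y → Measure Z} [∀ y, IsProbabilityMeasure (κ y)] [∀ y, IsProbabilityMeasure (η y)]
    (h : ∀ A, MeasurableSet A → ∀ᵐ y ∂ν, κ y A = η y A) : ∀ᵐ y ∂ν, κ y = η y := by
  -- A countable generating algebra is a π-system, so only countably many null sets are discarded.
  set 𝒜 := generateSetAlgebra (MeasurableSpace.countableGeneratingSet Z)
  have h𝒜 : 𝒜.Countable :=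
    countable_generateSetAlgebra (MeasurableSpace.countable_countableGeneratingSet)
  have hgen : ‹MeasurableSpace Z› = MeasurableSpace.generateFrom 𝒜 := by
    rw [generateFrom_generateSetAlgebra_eq,
      MeasurableSpace.generateFrom_countableGeneratingSet]
  have hmeas : ∀ A ∈ 𝒜, MeasurableSet A := fun A hA => by
    rw [hgen]; exact MeasurableSpace.measurableSet_generateFrom hA
  have := (ae_ball_iff h𝒜).2 fun A hA => h A (hmeas A hA)
  filter_upwards [this] with y hy
  exact ext_of_generate_finite 𝒜 hgen isSetAlgebra_generateSetAlgebra.isSetRing.isSetSemiring.isPiSystem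
    (fun A hA => hy A hA) (by simp)

theorem ae_condMeasure_null {N : Set X} (hN : μ N = 0) : ∀ᵐ x ∂μ, condMeasure μ s x N = 0 := by
  have h0 := setLIntegral_condMeasure μ s (@MeasurableSet.univ X (partitionSigma s))
    (measurableSet_toMeasurable μ N)
  rw [inter_univ, measure_toMeasurable, hN, Measure.restrict_univ, lintegral_eq_zero_iff
    ((measurable_condMeasure_apply μ s (measurableSet_toMeasurable μ N)).mono
      (partitionSigma_le s) le_rfl)] at h0
  filter_upwards [h0] with x hx
  exact measure_mono_null (subset_toMeasurable μ N) hx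

theorem ae_condMeasure_ae {p : X → Prop} (hp : ∀ᵐ x ∂μ, p x) :
    ∀ᵐ x ∂μ, ∀ᵐ y ∂(condMeasure μ s x), p y :=
  ae_condMeasure_null μ s hp

theorem ae_condMeasure_mem {A : Set X} (hA : MeasurableSet[partitionSigma s] A) :
    ∀ᵐ x ∂μ, x ∈ A → ∀ᵐ y ∂(condMeasure μ s x), y ∈ A := by
  have h0 := setLIntegral_condMeasure μ s hA hA.1.compl
  rw [compl_inter_self, measure_empty, lintegral_eq_zero_iff
    ((measurable_condMeasure_apply μ s hA.1.compl).mono (partitionSigma_le s) le_rfl),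
    EventuallyEq, ae_restrict_iff' hA.1] at h0
  exact h0

/-- Almost every conditional measure of a measurable partition is carried by its block. -/
theorem ae_condMeasure_block {f : X → ℝ} (hf : Measurable f) (hs : s = Setoid.ker f) :
    ∀ᵐ x ∂μ, ∀ᵐ y ∂(condMeasure μ s x), s x y := by
  subst hs
  -- Rational half-lines determine the value of `f` and cost only countably many null sets.
  have h1 : ∀ q : ℚ, ∀ᵐ x ∂μ, f x ≤ q → ∀ᵐ y ∂(condMeasure μ (Setoid.ker f) x), f y ≤ q :=
    fun q => ae_condMeasure_mem μ _ (A := {x | f x ≤ q})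
      ⟨measurableSet_le hf measurable_const, fun x y h => by
        simp only [mem_ofPred_eq, show f x = f y from h]⟩
  have h2 : ∀ q : ℚ, ∀ᵐ x ∂μ, q ≤ f x → ∀ᵐ y ∂(condMeasure μ (Setoid.ker f) x), q ≤ f y :=
    fun q => ae_condMeasure_mem μ _ (A := {x | q ≤ f x})
      ⟨measurableSet_le measurable_const hf, fun x y h => by
        simp only [mem_ofPred_eq, show f x = f y from h]⟩
  filter_upwards [ae_all_iff.2 h1, ae_all_iff.2 h2] with x hx1 hx2
  have h3 : ∀ᵐ y ∂(condMeasure μ (Setoid.ker f) x), ∀ q : ℚ, f x ≤ q → f y ≤ q :=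
    ae_all_iff.2 fun q => by
      by_cases hq : f x ≤ q
      · filter_upwards [hx1 q hq] with y hy _ using hy
      · exact ae_of_all _ fun y h => absurd h hq
  have h4 : ∀ᵐ y ∂(condMeasure μ (Setoid.ker f) x), ∀ q : ℚ, q ≤ f x → q ≤ f y :=
    ae_all_iff.2 fun q => by
      by_cases hq : q ≤ f x
      · filter_upwards [hx2 q hq] with y hy _ using hy
      · exact ae_of_all _ fun y h => absurd h hq
  filter_upwards [h3, h4] with y hy1 hy2
  refine le_antisymm (le_of_forall_rat_lt_imp_le fun q hq => hy2 q hq.le) ?_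
  exact le_of_forall_lt_rat_imp_le fun q hq => hy1 q hq.le

theorem measurable_lintegral_condMeasure {h : X → ℝ≥0∞} (hh : Measurable h) :
    Measurable[partitionSigma s] fun x => ∫⁻ y, h y ∂(condMeasure μ s x) :=
  (Measure.measurable_lintegral hh).comp (measurable_condMeasure μ s)

theorem lintegral_lintegral_condMeasure {h : X → ℝ≥0∞} (hh : Measurable h) :
    ∫⁻ x, ∫⁻ y, h y ∂(condMeasure μ s x) ∂μ = ∫⁻ y, h y ∂μ := by
  have hm := partitionSigma_le s
  conv_rhs => rw [← condExpKernel_comp_trim (μ := μ) hm]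
  rw [Measure.lintegral_bind (Kernel.aemeasurable _) hh.aemeasurable,
    ← lintegral_trim hm (measurable_lintegral_condMeasure μ s hh)]
  rfl

variable {μ s} in
theorem sameType_congr {ξ : ℕ → Setoid X} {n : ℕ} {x x' y y' : X} (hx : ξ n x x')
    (hy : ξ n y y') : SameType μ ξ n x y ↔ SameType μ ξ n x' y' := by
  unfold SameType
  rw [condMeasure_congr μ hx, condMeasure_congr μ hy, atoms_congr μ hx, atoms_congr μ hy]

variable {μ s} in
theorem isTreeCoupling_congr {ξ : ℕ → Setoid X} {n : ℕ} {x x' y y' : X} (hx : ξ n x x')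
    (hy : ξ n y y') (ψ : Measure (X × X)) :
    IsTreeCoupling μ ξ n x y ψ ↔ IsTreeCoupling μ ξ n x' y' ψ := by
  have hx' := condMeasure_congr μ hx
  have hy' := condMeasure_congr μ hy
  constructor <;> rintro ⟨h1, h2, h3, h4⟩
  · rw [hx'] at h1 h3
    rw [hy'] at h2 h4
    exact ⟨h1, h2, h3, h4⟩
  · rw [← hx'] at h1 h3
    rw [← hy'] at h2 h4
    exact ⟨h1, h2, h3, h4⟩

variable {μ s} in
theorem treeDist_congr {ξ : ℕ → Setoid X} {n : ℕ} {x x' y y' : X} (hx : ξ n x x')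
    (hy : ξ n y y') (ρ : X → X → ℝ) : treeDist μ ξ ρ n x y = treeDist μ ξ ρ n x' y' := by
  simp only [treeDist, isTreeCoupling_congr hx hy]

/-- A measurable function that is constant, mod 0, on the blocks of a measurable partition is
a.e. equal to a function that is measurable for the σ-algebra of the partition. -/
theorem exists_measurable_partitionSigma_ae_eq {Z : Type*} [MeasurableSpace Z]
    [StandardBorelSpace Z] [Nonempty Z] {μ : Measure X} {s : Setoid X} {f : X → ℝ}
    (hf : Measurable f) (hs : s = Setoid.ker f) {k : X → Z} (hk : Measurable k) {B : Set X}
    (hB : ∀ᵐ x ∂μ, x ∈ B) (h : ∀ x ∈ B, ∀ y ∈ B, s x y → k x = k y) :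
    ∃ g : X → Z, Measurable[partitionSigma s] g ∧ ∀ᵐ x ∂μ, k x = g x := by
  subst hs
  obtain ⟨N, hBN, hNm, hN⟩ := exists_measurable_superset_of_null (mem_ae_iff.1 hB)
  have hB' : ∀ x ∈ Nᶜ, x ∈ B := fun x hx => by_contra fun h => hx (hBN h)
  let f' : (Nᶜ : Set X) → ℝ := fun x => f x
  have hk' : Measurable[(inferInstance : MeasurableSpace ℝ).comap f']
      fun x : (Nᶜ : Set X) => k x := by
    intro U hU
    -- The two images are analytic, and disjoint because `k` is constant on blocks within `B`. Lusin
    -- separation gives a Borel set `u` of values of `f` that describes `k ⁻¹' U` off `N`.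
    have hd : Disjoint (f '' (Nᶜ ∩ k ⁻¹' U)) (f '' (Nᶜ ∩ k ⁻¹' Uᶜ)) := by
      rw [Set.disjoint_left]
      rintro _ ⟨x, ⟨hx, hxU⟩, rfl⟩ ⟨y, ⟨hy, hyU⟩, hxy⟩
      exact hyU (by simpa [h x (hB' x hx) y (hB' y hy) hxy.symm] using hxU)
    obtain ⟨u, hu1, hu2, hu⟩ := AnalyticSet.measurablySeparable
      ((hNm.compl.inter (hk hU)).analyticSet_image hf)
      ((hNm.compl.inter (hk hU.compl)).analyticSet_image hf) hd
    refine ⟨u, hu, ?_⟩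
    ext ⟨x, hx⟩
    by_cases hxU : k x ∈ U
    · simp only [mem_preimage, hxU, iff_true]
      exact hu1 ⟨x, ⟨hx, hxU⟩, rfl⟩
    · simp only [mem_preimage, hxU, iff_false]
      exact Set.disjoint_left.1 hu2 ⟨x, ⟨hx, hxU⟩, rfl⟩
  obtain ⟨g, hg, hgk⟩ := hk'.exists_eq_measurable_comp
  refine ⟨g ∘ f, measurable_partitionSigma_iff (hg.comp hf) fun x y hxy => ?_, ?_⟩
  · exact congrArg g hxy
  · filter_upwards [compl_mem_ae_iff.2 hN] with x hx
    exact congrFun hgk ⟨x, hx⟩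

end Conditional

/-! ### Isomorphisms: test semimetrics and conditional measures -/

/-- One point of `S` is chosen in each covering set that meets `S`. This keeps separability under
pullbacks and under shrinking `S`, where a given dense set may be lost. -/
theorem exists_countable_dense_of_countable_cover {X : Type*} {ρ : X → X → ℝ} {S : Set X}
    {𝒞 : Set (Set X)} (h𝒞 : 𝒞.Countable)
    (h : ∀ x ∈ S, ∀ ε > 0, ∃ C ∈ 𝒞, x ∈ C ∧ ∀ y ∈ C, y ∈ S → ρ x y < ε) :
    ∃ Q ⊆ S, Q.Countable ∧ ∀ x ∈ S, ∀ ε > 0, ∃ q ∈ Q, ρ x q < ε := by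
  classical
  rcases S.eq_empty_or_nonempty with rfl | ⟨x₀, hx₀⟩
  · exact ⟨∅, subset_rfl, countable_empty, fun x hx => absurd hx (notMem_empty x)⟩
  have : ∀ C : Set X, ∃ q ∈ S, (C ∩ S).Nonempty → q ∈ C := fun C => by
    by_cases hC : (C ∩ S).Nonempty
    · exact ⟨hC.some, hC.some_mem.2, fun _ => hC.some_mem.1⟩
    · exact ⟨x₀, hx₀, fun h => absurd h hC⟩
  choose q hqS hqC using this
  refine ⟨q '' 𝒞, by rintro _ ⟨C, -, rfl⟩; exact hqS C, h𝒞.image q, fun x hx ε hε => ?_⟩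
  obtain ⟨C, hC, hxC, hCε⟩ := h x hx ε hε
  exact ⟨q C, mem_image_of_mem q hC, hCε _ (hqC C ⟨x, hxC, hx⟩) (hqS C)⟩

section Isomorphism

variable {X Y : Type*} [MeasurableSpace X] [MeasurableSpace Y] {φ : X → Y} {θ : Y → X}

theorem IsTest.comp {μ : Measure X} {ν : Measure Y} [IsProbabilityMeasure μ]
    [IsProbabilityMeasure ν] (hφ : MeasurePreserving φ μ ν) (h1 : ∀ᵐ x ∂μ, θ (φ x) = x)
    {t : TestKind} {ρ : Y → Y → ℝ} (h : IsTest ν t ρ) :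
    IsTest μ t fun x x' => ρ (φ x) (φ x') := by
  cases t with
  | function =>
    obtain ⟨f, hf, rfl⟩ := h
    exact ⟨f ∘ φ, hf.comp_measurePreserving hφ, rfl⟩
  | cut =>
    obtain ⟨m, c, hc, rfl⟩ := h
    exact ⟨m, c ∘ φ, hc.comp_quasiMeasurePreserving hφ.quasiMeasurePreserving, rfl⟩
  | metric =>
    obtain ⟨hint, S, hS, hS0, hS1, hS2, Q, hQS, hQ, hQd⟩ := h
    -- Where `θ` inverts `φ`, the map `φ` is injective, so the pullback still separates points.
    refine ⟨(hφ.prod hφ).integrable_comp_of_integrable hint,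
      {x | φ x ∈ S ∧ θ (φ x) = x}, ?_, ?_, ?_, ?_, ?_⟩
    · filter_upwards [hφ.quasiMeasurePreserving.ae hS, h1] with x hx hx' using ⟨hx, hx'⟩
    · rintro x ⟨hx, hx'⟩ y ⟨hy, hy'⟩
      rw [hS0 _ hx _ hy]
      exact ⟨fun h => by rw [← hx', ← hy', h], fun h => by rw [h]⟩
    · exact fun x hx y hy => hS1 _ hx.1 _ hy.1
    · exact fun x hx y hy z hz => hS2 _ hx.1 _ hy.1 _ hz.1
    · refine exists_countable_dense_of_countable_cover
        (𝒞 := ⋃ q ∈ Q, range fun n : ℕ => {x | ρ (φ x) q < 1 / ((n : ℝ) + 1)})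
        (hQ.biUnion fun q _ => countable_range _) fun x hx ε hε => ?_
      obtain ⟨n, hn⟩ := exists_nat_one_div_lt (half_pos hε)
      obtain ⟨q, hq, hxq⟩ := hQd (φ x) hx.1 (1 / ((n : ℝ) + 1)) (by positivity)
      refine ⟨_, mem_biUnion hq ⟨n, rfl⟩, hxq, fun y hy hyS => ?_⟩
      have h3 := hS2 _ hx.1 _ (hQS hq) _ hyS.1
      rw [hS1 _ (hQS hq) _ hyS.1] at h3
      have h4 : ρ (φ y) q < 1 / ((n : ℝ) + 1) := hy
      linarith

variable [StandardBorelSpace X] [StandardBorelSpace Y]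

/-- An isomorphism of measurable partitions takes conditional measures to conditional measures. -/
theorem ae_condMeasure_eq_map {μ : Measure X} {ν : Measure Y} [IsProbabilityMeasure μ]
    [IsProbabilityMeasure ν] (hφ : MeasurePreserving φ μ ν) (hθ : MeasurePreserving θ ν μ)
    (h2 : ∀ᵐ y ∂ν, φ (θ y) = y) {s : Setoid X} {r : Setoid Y}
    (hs : ∃ f : X → ℝ, Measurable f ∧ s = Setoid.ker f)
    (hr : ∃ f : Y → ℝ, Measurable f ∧ r = Setoid.ker f) {S : Set X} (hS : ∀ᵐ x ∂μ, x ∈ S)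
    (h : ∀ x ∈ S, ∀ x' ∈ S, s x x' ↔ r (φ x) (φ x')) :
    ∀ᵐ y ∂ν, condMeasure ν r y = (condMeasure μ s (θ y)).map φ := by
  obtain ⟨f, hf, hsf⟩ := hs
  obtain ⟨f', hf', hrf⟩ := hr
  have : ∀ y, IsProbabilityMeasure ((condMeasure μ s (θ y)).map φ) := fun y =>
    Measure.isProbabilityMeasure_map hφ.measurable.aemeasurable
  refine ae_eq_of_forall_apply_ae_eq fun A hA => ?_
  have hcm : Measurable fun x => condMeasure μ s x (φ ⁻¹' A) :=
    (measurable_condMeasure_apply μ s (hφ.measurable hA)).mono (partitionSigma_le s) le_rfl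
  -- The candidate is constant on blocks of `r` only within `B`; it is replaced by a version `g`
  -- that is constant on whole blocks.
  obtain ⟨g, hg, hgk⟩ := exists_measurable_partitionSigma_ae_eq (μ := ν) hf' hrf
    (k := fun y => condMeasure μ s (θ y) (φ ⁻¹' A)) (hcm.comp hθ.measurable)
    (B := {y | φ (θ y) = y ∧ θ y ∈ S})
    (by filter_upwards [h2, hθ.quasiMeasurePreserving.ae hS] with y hy hy' using ⟨hy, hy'⟩)
    (by
      rintro y ⟨hy, hyS⟩ y' ⟨hy', hyS'⟩ hyy
      simp only [condMeasure_congr μ ((h _ hyS _ hyS').2 (by rwa [hy, hy']))])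
  refine (condMeasure_apply_ae_eq ν r hA hg fun V hV => ?_).mp ?_
  -- Similarly `φ ⁻¹' V` is saturated only within `S`; the set `w ⁻¹' {1}` is truly saturated and
  -- equals it mod 0.
  · obtain ⟨w, hw, hwk⟩ := exists_measurable_partitionSigma_ae_eq (μ := μ) hf hsf
      (k := fun x => V.indicator (1 : Y → ℝ≥0∞) (φ x))
      ((measurable_one.indicator hV.1).comp hφ.measurable) hS
      (by
        intro x hx x' hx' hxx
        have := hV.2 _ _ ((h x hx x' hx').1 hxx)
        by_cases hxV : φ x ∈ V
        · simp [hxV, this.1 hxV]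
        · simp [hxV, mt this.2 hxV])
    have hW := hw (measurableSet_singleton 1)
    have hVW : ∀ᵐ x ∂μ, φ x ∈ V ↔ x ∈ w ⁻¹' {1} := by
      filter_upwards [hwk] with x hx
      rw [mem_preimage, mem_singleton_iff, ← hx]
      by_cases hxV : φ x ∈ V <;> simp [hxV]
    have hVW' : V =ᵐ[ν] θ ⁻¹' (w ⁻¹' {1}) := by
      filter_upwards [h2, hθ.quasiMeasurePreserving.ae hVW] with y hy hy'
      rw [hy] at hy'
      exact propext hy'
    calc ∫⁻ y in V, g y ∂ν = ∫⁻ y in V, condMeasure μ s (θ y) (φ ⁻¹' A) ∂ν :=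
          lintegral_congr_ae (ae_restrict_of_ae (hgk.mono fun y hy => hy.symm))
      _ = ∫⁻ y in θ ⁻¹' (w ⁻¹' {1}), condMeasure μ s (θ y) (φ ⁻¹' A) ∂ν :=
          setLIntegral_congr hVW'
      _ = ∫⁻ x in w ⁻¹' {1}, condMeasure μ s x (φ ⁻¹' A) ∂μ :=
          hθ.setLIntegral_comp_preimage hW.1 hcm
      _ = μ (φ ⁻¹' A ∩ w ⁻¹' {1}) := setLIntegral_condMeasure μ s hW (hφ.measurable hA)
      _ = μ (φ ⁻¹' (A ∩ V)) := measure_congr (by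
          filter_upwards [hVW] with x hx
          exact propext (and_congr_right fun _ => hx.symm))
      _ = ν (A ∩ V) := hφ.measure_preimage (hA.inter hV.1).nullMeasurableSet
  · filter_upwards [hgk] with y hy hy'
    rw [hy', ← hy, Measure.map_apply hφ.measurable hA]

end Isomorphism

/-! ### Transfer of trees, couplings and the criterion along an isomorphism -/

/-- `φ` and `θ` are mutually inverse bijections between `A` and `B`, and take the partitions `ξ`
to the partitions `ζ`. -/
structure IsPartitionIsoOn {X Y : Type*} (φ : X → Y) (θ : Y → X) (A : Set X) (B : Set Y)
    (ξ : ℕ → Setoid X) (ζ : ℕ → Setoid Y) : Prop where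
  map_mem : ∀ x ∈ A, φ x ∈ B
  left_inv : ∀ x ∈ A, θ (φ x) = x
  inv_mem : ∀ y ∈ B, θ y ∈ A
  right_inv : ∀ y ∈ B, φ (θ y) = y
  rel_iff : ∀ x ∈ A, ∀ x' ∈ A, ∀ k, ξ k x x' ↔ ζ k (φ x) (φ x')

section Transfer

theorem map_swap_prod {Z : Type*} [MeasurableSpace Z] (ψ : Measure (Z × Z)) (U V : Set Z) :
    ψ.map Prod.swap (U ×ˢ V) = ψ (V ×ˢ U) :=
  (MeasurableEquiv.prodComm.map_apply (μ := ψ) (U ×ˢ V)).trans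
    (congrArg ψ (preimage_swap_prod U V))

variable {X Y : Type*} {φ : X → Y} {θ : Y → X}
  {A : Set X} {B : Set Y} {ξ : ℕ → Setoid X} {ζ : ℕ → Setoid Y}

theorem mem_of_measure_singleton_ne_zero [MeasurableSpace X] {κ : Measure X} (hκ : ∀ᵐ x ∂κ, x ∈ A) {x : X}
    (hx : κ {x} ≠ 0) : x ∈ A := by
  by_contra h
  exact hx (measure_mono_null (singleton_subset_iff.2 h) hκ)

namespace IsPartitionIsoOn

theorem rel_inv_iff (h : IsPartitionIsoOn φ θ A B ξ ζ) {y y' : Y} (hy : y ∈ B) (hy' : y' ∈ B)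
    (k : ℕ) : ξ k (θ y) (θ y') ↔ ζ k y y' := by
  rw [h.rel_iff _ (h.inv_mem y hy) _ (h.inv_mem y' hy'), h.right_inv y hy, h.right_inv y' hy']

theorem eq_iff (h : IsPartitionIsoOn φ θ A B ξ ζ) {y : Y} {x : X} (hy : y ∈ B) (hx : x ∈ A) :
    φ x = y ↔ x = θ y :=
  ⟨fun e => by rw [← e, h.left_inv x hx], fun e => by rw [e, h.right_inv y hy]⟩

theorem rel_map_iff (h : IsPartitionIsoOn φ θ A B ξ ζ) {y : Y} {x : X} (hy : y ∈ B) (hx : x ∈ A)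
    (k : ℕ) : ζ k y (φ x) ↔ ξ k (θ y) x := by
  rw [h.rel_iff _ (h.inv_mem y hy) _ hx, h.right_inv y hy]

variable [MeasurableSpace X] [MeasurableSpace Y] [MeasurableSingletonClass Y]

theorem map_singleton (h : IsPartitionIsoOn φ θ A B ξ ζ) (hφ : Measurable φ)
    {κ : Measure X} (hκ : ∀ᵐ x ∂κ, x ∈ A) {y : Y} (hy : y ∈ B) : κ.map φ {y} = κ {θ y} := by
  rw [Measure.map_apply hφ (measurableSet_singleton _)]
  refine measure_congr ?_
  filter_upwards [hκ] with z hz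
  exact propext (h.eq_iff hy hz)

/-- The image of a measure that satisfies the condition of a tree coupling for the first
coordinate also satisfies this condition. -/
theorem tree_condition_map (h : IsPartitionIsoOn φ θ A B ξ ζ) (hφ : Measurable φ)
    (hζ : ∀ k v, MeasurableSet {v' | ζ k v v'}) {ψ : Measure (X × X)} {κ : Measure X}
    (hψ : ∀ᵐ p ∂ψ, p.1 ∈ A ∧ p.2 ∈ A) (hκ : ∀ᵐ x ∂κ, x ∈ A) {k : ℕ}
    (hk : ∀ u v : X, ψ ({u} ×ˢ {v' | ξ k v v'}) * κ {u' | ξ k u u'} =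
      κ {u} * ψ ({u' | ξ k u u'} ×ˢ {v' | ξ k v v'})) (u v : Y) :
    ψ.map (Prod.map φ φ) ({u} ×ˢ {v' | ζ k v v'}) * κ.map φ {u' | ζ k u u'} =
      κ.map φ {u} * ψ.map (Prod.map φ φ) ({u' | ζ k u u'} ×ˢ {v' | ζ k v v'}) := by
  have hφ2 : Measurable (Prod.map φ φ) := hφ.prodMap hφ
  -- If the class of `v` meets `B`, a representative in `B` can be pulled back by `θ`. If it misses
  -- `B`, or if `u` is outside `B`, both sides vanish.
  by_cases hv : ∃ v₀ ∈ B, ζ k v v₀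
  · obtain ⟨v₀, hv₀, hvv⟩ := hv
    have hvs : {v' | ζ k v v'} = {v' | ζ k v₀ v'} := by
      ext v'
      exact ⟨fun e => (ζ k).trans ((ζ k).symm hvv) e, fun e => (ζ k).trans hvv e⟩
    rw [hvs]
    by_cases hu : u ∈ B
    · rw [h.map_singleton hφ hκ hu, Measure.map_apply hφ (hζ k u),
        Measure.map_apply hφ2 ((measurableSet_singleton u).prod (hζ k v₀)),
        Measure.map_apply hφ2 ((hζ k u).prod (hζ k v₀))]
      convert hk (θ u) (θ v₀) using 2
      · refine measure_congr ?_
        filter_upwards [hψ] with p hp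
        exact propext (and_congr (h.eq_iff hu hp.1) (h.rel_map_iff hv₀ hp.2 k))
      · refine measure_congr ?_
        filter_upwards [hκ] with x hx
        exact propext (h.rel_map_iff hu hx k)
      · refine measure_congr ?_
        filter_upwards [hψ] with p hp
        exact propext (and_congr (h.rel_map_iff hu hp.1 k) (h.rel_map_iff hv₀ hp.2 k))
    · have e1 : ψ.map (Prod.map φ φ) ({u} ×ˢ {v' | ζ k v₀ v'}) = 0 := by
        rw [Measure.map_apply hφ2 ((measurableSet_singleton u).prod (hζ k v₀))]
        refine measure_mono_null ?_ hψ
        rintro p ⟨hp, -⟩ hpA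
        exact hu ((show φ p.1 = u from hp) ▸ h.map_mem _ hpA.1)
      have e2 : κ.map φ {u} = 0 := by
        rw [Measure.map_apply hφ (measurableSet_singleton u)]
        refine measure_mono_null ?_ hκ
        rintro x hx hxA
        exact hu ((show φ x = u from hx) ▸ h.map_mem _ hxA)
      rw [e1, e2, zero_mul, zero_mul]
  · have e : ∀ U : Set Y, MeasurableSet U →
        ψ.map (Prod.map φ φ) (U ×ˢ {v' | ζ k v v'}) = 0 := fun U hU => by
      rw [Measure.map_apply hφ2 (hU.prod (hζ k v))]
      refine measure_mono_null ?_ hψ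
      rintro p ⟨-, hp⟩ hpA
      exact hv ⟨φ p.2, h.map_mem _ hpA.2, hp⟩
    rw [e _ (measurableSet_singleton u), e _ (hζ k u), zero_mul, mul_zero]

end IsPartitionIsoOn

/-- A point of `B` at which the conditional measures of `ξ n` and `ζ n` correspond to each other
and are carried by `A` and `B`. -/
structure IsRegularPoint [MeasurableSpace X] [MeasurableSpace Y] [StandardBorelSpace X] [StandardBorelSpace Y] (φ : X → Y) (θ : Y → X)
    (A : Set X) (B : Set Y) (μ : Measure X) (ν : Measure Y) [IsFiniteMeasure μ]
    [IsFiniteMeasure ν] (s : Setoid X) (r : Setoid Y) (y : Y) : Prop where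
  mem : y ∈ B
  eq_map : condMeasure ν r y = (condMeasure μ s (θ y)).map φ
  ae_mem : ∀ᵐ x ∂(condMeasure μ s (θ y)), x ∈ A
  ae_mem' : ∀ᵐ z ∂(condMeasure ν r y), z ∈ B

variable [MeasurableSpace X] [MeasurableSpace Y] [StandardBorelSpace X]
  [StandardBorelSpace Y] {μ : Measure X} {ν : Measure Y}
  [IsFiniteMeasure μ] [IsFiniteMeasure ν]

/-- The bijection is `φ` with inverse `θ`: a point of positive conditional measure belongs to every
set of full conditional measure, hence to `A` or to `B`. -/
theorem IsRegularPoint.exists_atoms_equiv (h : IsPartitionIsoOn φ θ A B ξ ζ)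
    (hφ : Measurable φ) {n : ℕ} {y : Y} (hy : IsRegularPoint φ θ A B μ ν (ξ n) (ζ n) y) :
    ∃ e : atoms μ (ξ n) (θ y) ≃ atoms ν (ζ n) y,
      (∀ u, condMeasure μ (ξ n) (θ y) {u.1} = condMeasure ν (ζ n) y {(e u).1}) ∧
      ∀ k u v, ξ k u.1 v.1 ↔ ζ k (e u).1 (e v).1 := by
  have hA : ∀ u ∈ atoms μ (ξ n) (θ y), u ∈ A := fun u hu =>
    mem_of_measure_singleton_ne_zero hy.ae_mem hu.2
  have hB : ∀ v ∈ atoms ν (ζ n) y, v ∈ B := fun v hv =>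
    mem_of_measure_singleton_ne_zero hy.ae_mem' hv.2
  have hsing : ∀ v ∈ B, condMeasure ν (ζ n) y {v} = condMeasure μ (ξ n) (θ y) {θ v} :=
    fun v hv => by rw [hy.eq_map, h.map_singleton hφ hy.ae_mem hv]
  have hsing' : ∀ u ∈ A, condMeasure ν (ζ n) y {φ u} = condMeasure μ (ξ n) (θ y) {u} :=
    fun u hu => by rw [hsing _ (h.map_mem u hu), h.left_inv u hu]
  refine ⟨⟨fun u => ⟨φ u, ?_, ?_⟩, fun v => ⟨θ v, ?_, ?_⟩, fun u => ?_, fun v => ?_⟩,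
    fun u => ?_, fun k u v => ?_⟩
  · exact (h.rel_map_iff hy.mem (hA u u.2) n).2 u.2.1
  · rw [hsing' u (hA u u.2)]
    exact u.2.2
  · exact (h.rel_inv_iff hy.mem (hB v v.2) n).2 v.2.1
  · rw [← hsing _ (hB v v.2)]
    exact v.2.2
  · exact Subtype.ext (h.left_inv u (hA u u.2))
  · exact Subtype.ext (h.right_inv v (hB v v.2))
  · exact (hsing' u (hA u u.2)).symm
  · exact h.rel_iff u (hA u u.2) v (hA v v.2) k

theorem SameType.of_regularPoint (h : IsPartitionIsoOn φ θ A B ξ ζ) (hφ : Measurable φ) {n : ℕ}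
    {y y' : Y} (hy : IsRegularPoint φ θ A B μ ν (ξ n) (ζ n) y)
    (hy' : IsRegularPoint φ θ A B μ ν (ξ n) (ζ n) y') (hyy : SameType ν ζ n y y') :
    SameType μ ξ n (θ y) (θ y') := by
  obtain ⟨e, he1, he2⟩ := hy.exists_atoms_equiv h hφ
  obtain ⟨e', he1', he2'⟩ := hy'.exists_atoms_equiv h hφ
  obtain ⟨i, hi1, hi2⟩ := hyy
  refine ⟨(e.trans i).trans e'.symm, fun u => ?_, fun k hk u v => ?_⟩
  · rw [he1, hi1, he1']
    simp
  · rw [he2, hi2 k hk, he2']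
    simp

theorem IsTreeCoupling.map_of_regularPoint (h : IsPartitionIsoOn φ θ A B ξ ζ)
    (hφ : Measurable φ) (hζ : ∀ k v, MeasurableSet {v' | ζ k v v'}) {n : ℕ} {y y' : Y}
    (hy : IsRegularPoint φ θ A B μ ν (ξ n) (ζ n) y)
    (hy' : IsRegularPoint φ θ A B μ ν (ξ n) (ζ n) y') {ψ : Measure (X × X)}
    (hψ : IsTreeCoupling μ ξ n (θ y) (θ y') ψ) :
    IsTreeCoupling ν ζ n y y' (ψ.map (Prod.map φ φ)) := by
  have hφ2 : Measurable (Prod.map φ φ) := hφ.prodMap hφ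
  have hψA : ∀ᵐ p ∂ψ, p.1 ∈ A ∧ p.2 ∈ A := by
    have h1 := hy.ae_mem
    have h2 := hy'.ae_mem
    rw [← hψ.map_fst] at h1
    rw [← hψ.map_snd] at h2
    exact (ae_of_ae_map measurable_fst.aemeasurable h1).and
      (ae_of_ae_map measurable_snd.aemeasurable h2)
  refine ⟨?_, ?_, fun k hk u v => ?_, fun k hk u v => ?_⟩
  · rw [Measure.map_map measurable_fst hφ2, hy.eq_map, ← hψ.map_fst,
      Measure.map_map hφ measurable_fst]
    rfl
  · rw [Measure.map_map measurable_snd hφ2, hy'.eq_map, ← hψ.map_snd,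
      Measure.map_map hφ measurable_snd]
    rfl
  · rw [hy.eq_map]
    exact h.tree_condition_map hφ hζ hψA hy.ae_mem (hψ.tree_fst k hk) u v
  -- The condition for the second coordinate is the condition for the first coordinate of the
  -- swapped coupling.
  · have := h.tree_condition_map hφ hζ (ψ := ψ.map Prod.swap) (k := k)
      ((MeasurableEquiv.prodComm.measurableEmbedding.ae_map_iff).2
        (hψA.mono fun p hp => ⟨hp.2, hp.1⟩)) hy'.ae_mem
      (fun u v => by simpa only [map_swap_prod] using hψ.tree_snd k hk v u) v u
    rw [Measure.map_map hφ2 measurable_swap,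
      show Prod.map φ φ ∘ Prod.swap = Prod.swap ∘ Prod.map φ φ from rfl,
      ← Measure.map_map measurable_swap hφ2, map_swap_prod, map_swap_prod, ← hy'.eq_map] at this
    exact this

/-- Each coupling upstairs pushes forward without raising the cost. Only this inequality is needed,
and `lintegral_map_le` asks for no measurability of `ρ`. -/
theorem treeDist_le_of_regularPoint (h : IsPartitionIsoOn φ θ A B ξ ζ)
    (hφ : Measurable φ) (hζ : ∀ k v, MeasurableSet {v' | ζ k v v'}) {n : ℕ} {y y' : Y}
    (hy : IsRegularPoint φ θ A B μ ν (ξ n) (ζ n) y)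
    (hy' : IsRegularPoint φ θ A B μ ν (ξ n) (ζ n) y') (ρ : Y → Y → ℝ) :
    treeDist ν ζ ρ n y y' ≤ treeDist μ ξ (fun x x' => ρ (φ x) (φ x')) n (θ y) (θ y') :=
  le_iInf₂ fun _ hψ => iInf₂_le_of_le _ (hψ.map_of_regularPoint h hφ hζ hy hy')
    (lintegral_map_le _ _)

end Transfer

/-- Isomorphisms of filtrations preserve the condition of the criterion for one semimetric. -/
theorem CollapsesWithinTypes.of_iso {X Y : Type*} [MeasurableSpace X] [MeasurableSpace Y]
    [StandardBorelSpace X] [StandardBorelSpace Y] {μ : Measure X} {ν : Measure Y}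
    [IsProbabilityMeasure μ] [IsProbabilityMeasure ν] {φ : X → Y} {θ : Y → X}
    (hφ : MeasurePreserving φ μ ν) (hθ : MeasurePreserving θ ν μ)
    (h1 : ∀ᵐ x ∂μ, θ (φ x) = x) (h2 : ∀ᵐ y ∂ν, φ (θ y) = y)
    {ξ : ℕ → Setoid X} {ζ : ℕ → Setoid Y}
    (hξ : ∀ n, ∃ f : X → ℝ, Measurable f ∧ ξ n = Setoid.ker f)
    (hζ : ∀ n, ∃ f : Y → ℝ, Measurable f ∧ ζ n = Setoid.ker f) {S : Set X}
    (hS : ∀ᵐ x ∂μ, x ∈ S)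
    (h : ∀ x ∈ S, ∀ x' ∈ S, ∀ n, ξ n x x' ↔ ζ n (φ x) (φ x')) {ρ : Y → Y → ℝ}
    (hρ : CollapsesWithinTypes μ ξ fun x x' => ρ (φ x) (φ x')) :
    CollapsesWithinTypes ν ζ ρ := by
  intro ε hε
  obtain ⟨N, hN⟩ := hρ ε hε
  refine ⟨N, fun n hn => ?_⟩
  obtain ⟨D, hDm, hDε, η, hη, hD⟩ := hN n hn
  set A : Set X := {x | x ∈ S ∧ θ (φ x) = x} with hAdef
  set B : Set Y := {y | θ y ∈ A ∧ φ (θ y) = y} with hBdef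
  have hA : ∀ᵐ x ∂μ, x ∈ A := hS.and h1
  have hB : ∀ᵐ y ∂ν, y ∈ B := (hθ.quasiMeasurePreserving.ae hA).and h2
  have hiso : IsPartitionIsoOn φ θ A B ξ ζ :=
    ⟨fun x hx => ⟨by rwa [hx.2], congrArg φ hx.2⟩, fun x hx => hx.2, fun y hy => hy.1,
      fun y hy => hy.2, fun x hx x' hx' => h x hx.1 x' hx'.1⟩
  have hζm : ∀ k v, MeasurableSet {v' | ζ k v v'} := fun k v => by
    obtain ⟨f, hf, hk⟩ := hζ k
    rw [hk]
    exact measurableSet_eq_fun measurable_const hf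
  set G : Set Y := {y | IsRegularPoint φ θ A B μ ν (ξ n) (ζ n) y} with hGdef
  have hG : ∀ᵐ y ∂ν, y ∈ G := by
    filter_upwards [hB, ae_condMeasure_eq_map hφ hθ h2 (hξ n) (hζ n) hS
      (fun x hx x' hx' => h x hx x' hx' n),
      hθ.quasiMeasurePreserving.ae (ae_condMeasure_ae μ (ξ n) hA),
      ae_condMeasure_ae ν (ζ n) hB] with y hy1 hy2 hy3 hy4 using ⟨hy1, hy2, hy3, hy4⟩
  -- Only blocks with a regular representative are kept. Types and distances depend on blocks alone,
  -- so they can be computed at these representatives.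
  set E : Set (Quotient (ζ n)) :=
    Quotient.mk (ζ n) '' {y | y ∈ G ∧ Quotient.mk (ξ n) (θ y) ∈ D} with hEdef
  have hE : Quotient.mk (ζ n) ⁻¹' E =ᵐ[ν] θ ⁻¹' (Quotient.mk (ξ n) ⁻¹' D) := by
    filter_upwards [hG] with y hy
    refine propext ⟨?_, fun hyD => ⟨y, ⟨hy, hyD⟩, rfl⟩⟩
    rintro ⟨y₀, ⟨hy₀, hyD⟩, he⟩
    have : Quotient.mk (ξ n) (θ y₀) = Quotient.mk (ξ n) (θ y) :=
      Quotient.sound ((hiso.rel_inv_iff hy₀.mem hy.mem n).2 (Quotient.exact he))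
    rw [this] at hyD
    exact hyD
  refine ⟨E, ?_, ?_, η, hη, ?_⟩
  · exact (hDm.preimage hθ.quasiMeasurePreserving).congr hE.symm
  · rwa [measureReal_congr hE, measureReal_def, hθ.measure_preimage hDm, ← measureReal_def]
  · rintro y y' ⟨y₀, ⟨hy₀, hyD⟩, he⟩ ⟨y₀', ⟨hy₀', hyD'⟩, he'⟩ hyy
    have he := Quotient.exact he
    have he' := Quotient.exact he'
    rw [← treeDist_congr he he']
    rw [← sameType_congr he he'] at hyy
    exact (treeDist_le_of_regularPoint hiso hφ.measurable hζm hy₀ hy₀' ρ).trans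
      (hD _ _ hyD hyD' (hyy.of_regularPoint hiso hφ.measurable hy₀ hy₀'))

theorem StandardnessCriterion.of_iso {X Y : Type*} [MeasurableSpace X] [MeasurableSpace Y]
    [StandardBorelSpace X] [StandardBorelSpace Y] {μ : Measure X} {ν : Measure Y}
    [IsProbabilityMeasure μ] [IsProbabilityMeasure ν]
    {ξ : ℕ → Setoid X} {ζ : ℕ → Setoid Y}
    (hξ : ∀ n, ∃ f : X → ℝ, Measurable f ∧ ξ n = Setoid.ker f)
    (hζ : ∀ n, ∃ f : Y → ℝ, Measurable f ∧ ζ n = Setoid.ker f)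
    (h : IsomorphicFiltrations μ ξ ν ζ) {t : TestKind} (hμ : StandardnessCriterion t μ ξ) :
    StandardnessCriterion t ν ζ := by
  obtain ⟨φ, θ, hφ, hθ, h1, h2, S, hS, hr⟩ := h
  exact fun ρ hρ => .of_iso hφ hθ h1 h2 hξ hζ hS hr (hμ _ (hρ.comp hφ h1))

theorem IsomorphicFiltrations.symm {X Y : Type*} [MeasurableSpace X] [MeasurableSpace Y]
    {μ : Measure X} {ν : Measure Y} {ξ : ℕ → Setoid X} {ζ : ℕ → Setoid Y}
    (h : IsomorphicFiltrations μ ξ ν ζ) : IsomorphicFiltrations ν ζ μ ξ := by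
  obtain ⟨φ, θ, hφ, hθ, h1, h2, S, hS, hr⟩ := h
  refine ⟨θ, φ, hθ, hφ, h2, h1, {y | θ y ∈ S ∧ φ (θ y) = y},
    (hθ.quasiMeasurePreserving.ae hS).and h2, fun y hy y' hy' n => ?_⟩
  rw [hr _ hy.1 _ hy'.1, hy.2, hy'.2]

/-- Two copies of a measured tree, joined leaf by leaf, satisfy the condition of a tree coupling
for the first coordinate. -/
theorem tree_condition_of_parametrization {P X : Type*} [MeasurableSpace P] [MeasurableSpace X]
    [MeasurableSingletonClass X] {M : Measure P} {G G' : P → X} (hG : Measurable G)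
    (hG' : Measurable G') {r : Setoid X} (hr : ∀ v, MeasurableSet {v' | r v v'}) {A : Set P}
    (hA : ∀ᵐ p ∂M, p ∈ A) (h : ∀ p ∈ A, ∀ q ∈ A, r (G p) (G q) → r (G' p) (G' q)) (u v : X) :
    M.map (fun p => (G p, G' p)) ({u} ×ˢ {v' | r v v'}) * M.map G {u' | r u u'} =
      M.map G {u} * M.map (fun p => (G p, G' p)) ({u' | r u u'} ×ˢ {v' | r v v'}) := by
  have hGG : Measurable fun p => (G p, G' p) := hG.prodMk hG'
  rw [Measure.map_apply hGG ((measurableSet_singleton u).prod (hr v)),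
    Measure.map_apply hGG ((hr u).prod (hr v)), Measure.map_apply hG (hr u),
    Measure.map_apply hG (measurableSet_singleton u)]
  have hu : ∀ p, G p = u → r u (G p) := fun p hp => hp ▸ r.refl _
  -- If the classes of `u` and `v` are joined by one leaf of `A`, then each leaf of `A` over the
  -- class of `u` lies over that of `v`, so the second constraint is redundant. Otherwise both sides
  -- vanish.
  by_cases hex : ∃ p ∈ A, r u (G p) ∧ r v (G' p)
  · obtain ⟨p₁, hp₁, hup₁, hvp₁⟩ := hex
    have key : ∀ p ∈ A, r u (G p) → r v (G' p) := fun p hp hup =>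
      r.trans hvp₁ (h p₁ hp₁ p hp (r.trans (r.symm hup₁) hup))
    congr 1
    · refine measure_congr ?_
      filter_upwards [hA] with p hp
      exact propext ⟨fun e => e.1, fun e => ⟨e, key p hp (hu p e)⟩⟩
    · refine measure_congr ?_
      filter_upwards [hA] with p hp
      exact propext ⟨fun e => ⟨e, key p hp e⟩, fun e => e.1⟩
  · have e1 : M ((fun p => (G p, G' p)) ⁻¹' ({u' | r u u'} ×ˢ {v' | r v v'})) = 0 :=
      measure_mono_null (fun p hp hpA => hex ⟨p, hpA, hp.1, hp.2⟩) hA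
    have e2 : M ((fun p => (G p, G' p)) ⁻¹' ({u} ×ˢ {v' | r v v'})) = 0 :=
      measure_mono_null (fun p hp hpA => hex ⟨p, hpA, hu p hp.1, hp.2⟩) hA
    rw [e1, e2, zero_mul, mul_zero]

/-! ### Initial segments and tails of infinite paths -/

namespace EquippedMultigraph

variable {Γ : EquippedMultigraph}

instance (Γ : EquippedMultigraph) : MeasurableSpace (List Γ.E) := ⊤

instance (Γ : EquippedMultigraph) : DiscreteMeasurableSpace (List Γ.E) := ⟨fun _ => trivial⟩

theorem weight_pos (p : List Γ.E) : 0 < Γ.weight p := by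
  refine List.prod_pos fun a ha => ?_
  obtain ⟨e, -, rfl⟩ := List.mem_map.1 ha
  exact Γ.cotrans_pos e

theorem IsPathTo.length_eq : ∀ {p : List Γ.E} {v : Γ.V}, Γ.IsPathTo v p → p.length = Γ.level v
  | [], v, h => ((Γ.level_eq_zero v).2 h).symm
  | e :: p, v, h => by
    rw [List.length_cons, IsPathTo.length_eq h.2, ← h.1, Γ.level_tgt]

theorem IsPathTo.unique {p : List Γ.E} {v w : Γ.V} (hv : Γ.IsPathTo v p)
    (hw : Γ.IsPathTo w p) : v = w := by
  cases p with
  | nil => exact Eq.trans hv (Eq.symm hw)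
  | cons e p => exact hv.1.symm.trans hw.1

/-- The list of the first `n` edges of an infinite path, from the top down. -/
def initial (ω : Γ.PathSpace) : ℕ → List Γ.E
  | 0 => []
  | n + 1 => ω.1 n :: initial ω n

/-- The vertex of level `n` of an infinite path. -/
def vertex (n : ℕ) (ω : Γ.PathSpace) : Γ.V := Γ.src (ω.1 n)

theorem vertex_zero (ω : Γ.PathSpace) : vertex 0 ω = Γ.root := ω.2.1

theorem tgt_eq_vertex (n : ℕ) (ω : Γ.PathSpace) : Γ.tgt (ω.1 n) = vertex (n + 1) ω := ω.2.2 n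

theorem vertex_congr {n : ℕ} {ω ω' : Γ.PathSpace} (h : Γ.tail n ω ω') :
    vertex n ω = vertex n ω' :=
  congrArg Γ.src (h n le_rfl)

theorem isPathTo_initial (ω : Γ.PathSpace) : ∀ n, Γ.IsPathTo (vertex n ω) (initial ω n)
  | 0 => vertex_zero ω
  | n + 1 => ⟨tgt_eq_vertex n ω, isPathTo_initial ω n⟩

theorem level_vertex (n : ℕ) (ω : Γ.PathSpace) : Γ.level (vertex n ω) = n := by
  induction n with
  | zero => rw [vertex_zero, (Γ.level_eq_zero _).2 rfl]
  | succ n ih => rw [← tgt_eq_vertex, Γ.level_tgt, show Γ.src (ω.1 n) = vertex n ω from rfl, ih]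

theorem length_initial (ω : Γ.PathSpace) (n : ℕ) : (initial ω n).length = n := by
  rw [(isPathTo_initial ω n).length_eq, level_vertex]

theorem take_initial_eq_iff (x y : Γ.PathSpace) (k d : ℕ) :
    (initial x (k + d)).take d = (initial y (k + d)).take d ↔
      ∀ i, k ≤ i → i < k + d → x.1 i = y.1 i := by
  induction d with
  | zero => simp; omega
  | succ d ih =>
    rw [← Nat.add_assoc]
    simp only [initial, List.take_succ_cons, List.cons.injEq, ih]
    constructor
    · rintro ⟨h1, h2⟩ i hi hi'
      rcases Nat.lt_succ_iff_lt_or_eq.1 hi' with h | rfl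
      exacts [h2 i hi h, h1]
    · exact fun h => ⟨h _ (by omega) (by omega), fun i hi hi' => h i hi (by omega)⟩

theorem initial_eq_iff (x y : Γ.PathSpace) (n : ℕ) :
    initial x n = initial y n ↔ ∀ i < n, x.1 i = y.1 i := by
  have h := take_initial_eq_iff x y 0 n
  rw [Nat.zero_add, List.take_of_length_le (length_initial x n).le,
    List.take_of_length_le (length_initial y n).le] at h
  rw [h]
  exact ⟨fun h i hi => h i i.zero_le hi, fun h i _ hi => h i hi⟩

theorem eq_of_tail_of_initial_eq {x y : Γ.PathSpace} {n : ℕ} (h : Γ.tail n x y)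
    (h' : initial x n = initial y n) : x = y :=
  Subtype.ext <| funext fun i => (lt_or_ge i n).elim ((initial_eq_iff x y n).1 h' i) (h i)

/-- On a block of `tail n`, the partition `tail k` is determined by the top `n - k` edges of the
initial paths of length `n`. -/
theorem tail_iff_take_initial {x y : Γ.PathSpace} {n k : ℕ} (hk : k ≤ n) (h : Γ.tail n x y) :
    Γ.tail k x y ↔ (initial x n).take (n - k) = (initial y n).take (n - k) := by
  obtain ⟨d, rfl⟩ := Nat.exists_eq_add_of_le hk
  rw [Nat.add_sub_cancel_left, take_initial_eq_iff]
  exact ⟨fun h i hi _ => h i hi, fun h' i hi => (lt_or_ge i (k + d)).elim (h' i hi) (h i)⟩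

/-- Gluing a finite path to a tail. Only the entries of `s` from `n` on matter: the induction
overwrites the others one at a time, starting from the top edge. -/
theorem exists_path_of_isPathTo : ∀ (p : List Γ.E) (s : ℕ → Γ.E) (n : ℕ), p.length = n →
    Γ.IsPathTo (Γ.src (s n)) p → (∀ i, n ≤ i → Γ.tgt (s i) = Γ.src (s (i + 1))) →
    ∃ x : Γ.PathSpace, (∀ i, n ≤ i → x.1 i = s i) ∧ initial x n = p
  | [], s, n, hn, hp, hs => by
    obtain rfl : n = 0 := by simpa using hn.symm
    exact ⟨⟨s, hp, fun i => hs i i.zero_le⟩, fun i _ => rfl, rfl⟩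
  | e :: p, s, n, hn, hp, hs => by
    obtain ⟨m, rfl⟩ : ∃ m, n = m + 1 := ⟨p.length, by simpa using hn.symm⟩
    have hne : ∀ i, m + 1 ≤ i → Function.update s m e i = s i := fun i hi =>
      Function.update_of_ne (by omega) _ _
    obtain ⟨x, hx, hxp⟩ := exists_path_of_isPathTo p (Function.update s m e) m
      (by simpa using hn) (by simpa using hp.2) (fun i hi => by
        rcases hi.eq_or_lt with rfl | hi
        · rw [Function.update_self, hne _ le_rfl]
          exact hp.1
        · rw [hne _ hi, hne _ (by omega)]
          exact hs i hi)
    refine ⟨x, fun i hi => by rw [hx i (by omega), hne i hi], ?_⟩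
    rw [initial, hxp, hx m le_rfl, Function.update_self]

theorem exists_tail_initial_eq (ω : Γ.PathSpace) (n : ℕ) {p : List Γ.E}
    (hp : Γ.IsPathTo (vertex n ω) p) : ∃ x, Γ.tail n ω x ∧ initial x n = p := by
  obtain ⟨x, hx, hxp⟩ := exists_path_of_isPathTo p ω.1 n
    (by rw [hp.length_eq, level_vertex]) hp (fun i _ => ω.2.2 i)
  exact ⟨x, fun i hi => (hx i hi).symm, hxp⟩

theorem measurable_edge (i : ℕ) : Measurable fun ω : Γ.PathSpace => ω.1 i :=
  (measurable_pi_apply i).comp measurable_subtype_coe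

theorem measurable_initial (n : ℕ) : Measurable fun ω : Γ.PathSpace => initial ω n := by
  induction n with
  | zero => exact measurable_const
  | succ n ih =>
    exact (Measurable.of_discrete : Measurable fun q : Γ.E × List Γ.E => q.1 :: q.2).comp
      ((measurable_edge n).prodMk ih)

theorem exists_tail_eq_ker (Γ : EquippedMultigraph) (n : ℕ) :
    ∃ f : Γ.PathSpace → ℝ, Measurable f ∧ Γ.tail n = Setoid.ker f := by
  obtain ⟨g, hg⟩ := exists_measurableEmbedding_real (ℕ → Γ.E)
  refine ⟨fun ω => g fun i => ω.1 (n + i),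
    hg.measurable.comp (measurable_pi_lambda _ fun i => measurable_edge (n + i)), ?_⟩
  ext x y
  refine ⟨fun h => congrArg g (funext fun i => h _ (by omega)), fun h i hi => ?_⟩
  have := congrFun (hg.injective h) (i - n)
  simpa [Nat.add_sub_cancel' hi] using this

theorem measurableSet_tail (n : ℕ) (x : Γ.PathSpace) : MeasurableSet {y | Γ.tail n x y} := by
  obtain ⟨f, hf, h⟩ := Γ.exists_tail_eq_ker n
  rw [h]
  exact measurableSet_eq_fun measurable_const hf

theorem measurableSet_partitionSigma_edge {n i : ℕ} (hi : n ≤ i) (U : Set Γ.E) :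
    MeasurableSet[partitionSigma (Γ.tail n)] {ω : Γ.PathSpace | ω.1 i ∈ U} :=
  ⟨measurable_edge i (MeasurableSet.of_discrete (s := U)),
    fun x y h => by simp only [mem_ofPred_eq, h i hi]⟩

theorem partitionSigma_tail_anti (n : ℕ) :
    partitionSigma (Γ.tail (n + 1)) ≤ partitionSigma (Γ.tail n) :=
  fun _ hA => ⟨hA.1, fun x y h => hA.2 x y fun i hi => h i (by omega)⟩

/-- The one-step condition is iterated downwards: fixing the top edge of `p` turns `B` into a set
measurable for the finer partition `tail m`, to which the induction hypothesis applies. -/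
theorem Agrees.measure_initial_inter {ν : Measure Γ.PathSpace} (hν : Γ.Agrees ν) :
    ∀ (p : List Γ.E) (v : Γ.V) (n : ℕ) (B : Set Γ.PathSpace), p.length = n → Γ.IsPathTo v p →
      MeasurableSet[partitionSigma (Γ.tail n)] B →
      ν ({ω | initial ω n = p} ∩ B) = ENNReal.ofReal (Γ.weight p) * ν ({ω | vertex n ω = v} ∩ B)
  | [], v, n, B, hn, hp, hB => by
    obtain rfl : n = 0 := by simpa using hn.symm
    have : v = Γ.root := hp
    simp [weight, initial, vertex_zero, this]
  | e :: p, v, n, B, hn, hp, hB => by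
    obtain ⟨m, rfl⟩ : ∃ m, n = m + 1 := ⟨p.length, by simpa using hn.symm⟩
    have hB' : MeasurableSet[partitionSigma (Γ.tail m)] ({ω | ω.1 m = e} ∩ B) :=
      (measurableSet_partitionSigma_edge le_rfl {e}).inter (partitionSigma_tail_anti m B hB)
    have ih := hν.measure_initial_inter p (Γ.src e) m _ (by simpa using hn) hp.2 hB'
    have e1 : {ω | initial ω (m + 1) = e :: p} ∩ B =
        {ω | initial ω m = p} ∩ ({ω : Γ.PathSpace | ω.1 m = e} ∩ B) := by
      ext ω
      simp only [initial, List.cons.injEq, mem_inter_iff, mem_ofPred_eq]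
      tauto
    have e2 : {ω | vertex m ω = Γ.src e} ∩ ({ω : Γ.PathSpace | ω.1 m = e} ∩ B) =
        {ω : Γ.PathSpace | ω.1 m = e} ∩ B :=
      inter_eq_right.2 fun ω hω => congrArg Γ.src hω.1
    rw [e1, ih, e2, hν m e B hB, hp.1, ← mul_assoc, ← ENNReal.ofReal_mul (weight_pos p).le]
    simp only [weight, List.map_cons, List.prod_cons, vertex, mul_comm]

/-! ### Regular paths and the coupling of blocks with a common vertex -/

/-- The conditional measure on the block of `ω` in `tail n` is carried by this block, and the
initial paths of length `n` have the measures prescribed by the equipment. -/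
structure IsRegularPath (ν : Measure Γ.PathSpace) [IsFiniteMeasure ν] (n : ℕ)
    (ω : Γ.PathSpace) : Prop where
  ae_tail : ∀ᵐ x ∂(condMeasure ν (Γ.tail n) ω), Γ.tail n ω x
  measure_initial : ∀ p, Γ.IsPathTo (vertex n ω) p →
    condMeasure ν (Γ.tail n) ω {x | initial x n = p} = ENNReal.ofReal (Γ.weight p)

section Regular

variable {ν : Measure Γ.PathSpace} [IsFiniteMeasure ν] {n : ℕ} {ω ω' : Γ.PathSpace}

theorem Agrees.ae_isRegularPath (hν : Γ.Agrees ν) (n : ℕ) :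
    ∀ᵐ ω ∂ν, IsRegularPath ν n ω := by
  have h : ∀ p : List Γ.E, ∀ᵐ ω ∂ν, Γ.IsPathTo (vertex n ω) p →
      condMeasure ν (Γ.tail n) ω {x | initial x n = p} = ENNReal.ofReal (Γ.weight p) := by
    intro p
    by_cases hp : ∃ v, Γ.IsPathTo v p ∧ Γ.level v = n
    · obtain ⟨v, hp, hv⟩ := hp
      have hvm : MeasurableSet[partitionSigma (Γ.tail n)] {ω : Γ.PathSpace | vertex n ω = v} :=
        measurableSet_partitionSigma_edge le_rfl {e | Γ.src e = v}
      -- The conditional probability of `p` is its weight on the blocks at the endpoint `v` of `p`,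
      -- and zero on the others.
      filter_upwards [condMeasure_apply_ae_eq ν (Γ.tail n)
        (measurable_initial n (measurableSet_singleton p))
        (g := {ω | vertex n ω = v}.indicator fun _ => ENNReal.ofReal (Γ.weight p))
        (measurable_const.indicator hvm) (fun B hB => by
          rw [lintegral_indicator_const hvm.1, Measure.restrict_apply hvm.1]
          exact (hν.measure_initial_inter p v n B (by rw [hp.length_eq, hv]) hp hB).symm)]
        with ω hω hpω
      exact hω.trans (indicator_of_mem (s := {ω | vertex n ω = v}) (hpω.unique hp) _)
    · exact ae_of_all _ fun ω hω => absurd ⟨_, hω, level_vertex n ω⟩ hp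
  obtain ⟨f, hf, hk⟩ := Γ.exists_tail_eq_ker n
  filter_upwards [ae_all_iff.2 h, ae_condMeasure_block ν (Γ.tail n) hf hk] with ω h1 h2
  exact ⟨h2, h1⟩

theorem IsRegularPath.congr (h : Γ.tail n ω ω') (hω : IsRegularPath ν n ω) :
    IsRegularPath ν n ω' := by
  obtain ⟨h1, h2⟩ := hω
  rw [condMeasure_congr ν h] at h1 h2
  rw [vertex_congr h] at h2
  exact ⟨h1.mono fun x hx => (Γ.tail n).trans ((Γ.tail n).symm h) hx, h2⟩

theorem IsRegularPath.measure_singleton (hω : IsRegularPath ν n ω) {x : Γ.PathSpace}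
    (hx : Γ.tail n ω x) :
    condMeasure ν (Γ.tail n) ω {x} = ENNReal.ofReal (Γ.weight (initial x n)) := by
  rw [← hω.measure_initial _ (by rw [vertex_congr hx]; exact isPathTo_initial x n)]
  refine measure_congr ?_
  filter_upwards [hω.ae_tail] with y hy
  refine propext ⟨fun h => congrArg (initial · n) h, fun h => ?_⟩
  exact eq_of_tail_of_initial_eq ((Γ.tail n).trans ((Γ.tail n).symm hy) hx) h

theorem IsRegularPath.mem_atoms_iff (hω : IsRegularPath ν n ω) {x : Γ.PathSpace} :
    x ∈ atoms ν (Γ.tail n) ω ↔ Γ.tail n ω x := by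
  refine ⟨fun h => h.1, fun h => ⟨h, ?_⟩⟩
  rw [hω.measure_singleton h]
  exact (ENNReal.ofReal_pos.2 (weight_pos _)).ne'

theorem IsRegularPath.exists_equiv (hω : IsRegularPath ν n ω) :
    ∃ e : atoms ν (Γ.tail n) ω ≃ {p : List Γ.E // Γ.IsPathTo (vertex n ω) p},
      ∀ x, (e x).1 = initial x.1 n := by
  refine ⟨Equiv.ofBijective (fun x => ⟨initial x.1 n, ?_⟩) ⟨fun x y h => ?_, fun p => ?_⟩,
    fun x => rfl⟩
  · rw [vertex_congr x.2.1]
    exact isPathTo_initial x.1 n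
  · exact Subtype.ext (eq_of_tail_of_initial_eq
      ((Γ.tail n).trans ((Γ.tail n).symm x.2.1) y.2.1) (congrArg Subtype.val h))
  · obtain ⟨x, hx, hxp⟩ := exists_tail_initial_eq ω n p.2
    exact ⟨⟨x, hω.mem_atoms_iff.2 hx⟩, Subtype.ext hxp⟩

/-- A regular block is the tree of its vertex, with atoms as finite paths and conditional measures
as weights; an isomorphism of blocks is thus one of path trees. -/
theorem IsMinimal.vertex_eq_of_sameType (hΓ : Γ.IsMinimal) (hω : IsRegularPath ν n ω)
    (hω' : IsRegularPath ν n ω') (h : SameType ν Γ.tail n ω ω') : vertex n ω = vertex n ω' := by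
  refine hΓ _ _ (by rw [level_vertex, level_vertex]) ?_
  obtain ⟨e, he⟩ := hω.exists_equiv
  obtain ⟨e', he'⟩ := hω'.exists_equiv
  obtain ⟨i, hi1, hi2⟩ := h
  refine ⟨(e.symm.trans i).trans e', fun p => ?_, fun j p q => ?_⟩
  · obtain ⟨x, rfl⟩ := e.surjective p
    have := hi1 x
    rw [hω.measure_singleton x.2.1, hω'.measure_singleton (i x).2.1,
      ENNReal.ofReal_eq_ofReal_iff (weight_pos _).le (weight_pos _).le] at this
    simpa [he, he'] using this
  · obtain ⟨x, rfl⟩ := e.surjective p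
    obtain ⟨y, rfl⟩ := e.surjective q
    simp only [Equiv.trans_apply, Equiv.symm_apply_apply, he, he']
    have hxy := (Γ.tail n).trans ((Γ.tail n).symm x.2.1) y.2.1
    have hxy' := (Γ.tail n).trans ((Γ.tail n).symm (i x).2.1) (i y).2.1
    -- Agreement of the top `j` edges is the partition `tail (n - j)`. The case `j = 0` is trivial
    -- and not covered by `SameType`, while `j > n` truncates to level `0`.
    rcases Nat.eq_zero_or_pos j with rfl | hj
    · simp
    · rcases Nat.eq_zero_or_pos n with rfl | hn
      · simp [initial]
      have key := hi2 (n - j) (by omega) x y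
      rw [tail_iff_take_initial (by omega) hxy, tail_iff_take_initial (by omega) hxy'] at key
      rcases le_or_gt j n with hjn | hjn
      · rwa [Nat.sub_sub_self hjn] at key
      · have ht : ∀ z : Γ.PathSpace, (initial z n).take j = (initial z n).take (n - (n - j)) :=
          fun z => by
            rw [List.take_of_length_le, List.take_of_length_le] <;> rw [length_initial] <;> omega
        rwa [ht, ht, ht, ht]

theorem IsRegularPath.ae_isPathTo (hω : IsRegularPath ν n ω) :
    ∀ᵐ p ∂((condMeasure ν (Γ.tail n) ω).map (initial · n)), Γ.IsPathTo (vertex n ω) p := by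
  rw [ae_map_iff (measurable_initial n).aemeasurable MeasurableSet.of_discrete]
  filter_upwards [hω.ae_tail] with x hx
  rw [vertex_congr hx]
  exact isPathTo_initial x n

theorem IsRegularPath.map_initial_eq (hω : IsRegularPath ν n ω) (hω' : IsRegularPath ν n ω')
    (h : vertex n ω = vertex n ω') :
    (condMeasure ν (Γ.tail n) ω).map (initial · n) =
      (condMeasure ν (Γ.tail n) ω').map (initial · n) := by
  refine Measure.ext_of_singleton fun p => ?_
  by_cases hp : Γ.IsPathTo (vertex n ω) p
  · rw [Measure.map_apply (measurable_initial n) (measurableSet_singleton p),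
      Measure.map_apply (measurable_initial n) (measurableSet_singleton p)]
    exact (hω.measure_initial p hp).trans (hω'.measure_initial p (h ▸ hp)).symm
  · have h1 := measure_mono_null (singleton_subset_iff.2 hp) hω.ae_isPathTo
    rw [h] at hp
    have h2 := measure_mono_null (singleton_subset_iff.2 hp) hω'.ae_isPathTo
    rw [h1, h2]

/-- The coupling of two blocks with the same vertex that joins the paths with the same initial
segment. -/
theorem IsRegularPath.treeDist_le (hω : IsRegularPath ν n ω) (hω' : IsRegularPath ν n ω')
    (hv : vertex n ω = vertex n ω') {ρ : Γ.PathSpace → Γ.PathSpace → ℝ}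
    {h : Γ.PathSpace → ℝ≥0∞} (hh : Measurable h) {S : Set Γ.PathSpace}
    (hS : ∀ᵐ x ∂(condMeasure ν (Γ.tail n) ω), x ∈ S)
    (hS' : ∀ᵐ x ∂(condMeasure ν (Γ.tail n) ω'), x ∈ S)
    (hρ : ∀ x ∈ S, ∀ y ∈ S, (∀ i < n, x.1 i = y.1 i) → ENNReal.ofReal (ρ x y) ≤ h x + h y) :
    treeDist ν Γ.tail ρ n ω ω' ≤
      ∫⁻ x, h x ∂(condMeasure ν (Γ.tail n) ω) + ∫⁻ x, h x ∂(condMeasure ν (Γ.tail n) ω') := by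
  -- `G ω p` has initial segment `p` and the tail of `ω`; its default value on other lists matters
  -- only on a null set.
  have hex : ∀ (ω : Γ.PathSpace) (p : List Γ.E), ∃ x, Γ.IsPathTo (vertex n ω) p →
      Γ.tail n ω x ∧ initial x n = p := fun ω p => by
    by_cases hp : Γ.IsPathTo (vertex n ω) p
    · obtain ⟨x, hx⟩ := exists_tail_initial_eq ω n hp
      exact ⟨x, fun _ => hx⟩
    · exact ⟨ω, fun h => absurd h hp⟩
  choose G hG using hex
  have hGm : ∀ ω, Measurable (G ω) := fun ω => Measurable.of_discrete
  have hmap : ∀ ω, IsRegularPath ν n ω →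
      ((condMeasure ν (Γ.tail n) ω).map (initial · n)).map (G ω) =
        condMeasure ν (Γ.tail n) ω := fun ω hω => by
    rw [Measure.map_map (hGm ω) (measurable_initial n)]
    conv_rhs => rw [← Measure.map_id (μ := condMeasure ν (Γ.tail n) ω)]
    refine Measure.map_congr ?_
    filter_upwards [hω.ae_tail] with x hx
    have hp : Γ.IsPathTo (vertex n ω) (initial x n) := by
      rw [vertex_congr hx]
      exact isPathTo_initial x n
    exact eq_of_tail_of_initial_eq
      ((Γ.tail n).trans ((Γ.tail n).symm (hG ω _ hp).1) hx) (hG ω _ hp).2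
  -- `M` is the common law of the initial path in both blocks, and `G ω` and `G ω'` recover the two
  -- conditional measures from it.
  set M := (condMeasure ν (Γ.tail n) ω).map (initial · n) with hM
  have hM1 : M.map (G ω) = condMeasure ν (Γ.tail n) ω := hmap ω hω
  have hM2 : M.map (G ω') = condMeasure ν (Γ.tail n) ω' := by
    rw [hM, hω.map_initial_eq hω' hv, hmap ω' hω']
  have hMA : ∀ᵐ p ∂M, p ∈ {p | Γ.IsPathTo (vertex n ω) p} := hω.ae_isPathTo
  have hrel : ∀ k < n, ∀ p ∈ {p | Γ.IsPathTo (vertex n ω) p},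
      ∀ q ∈ {p | Γ.IsPathTo (vertex n ω) p},
      (Γ.tail k (G ω p) (G ω q) ↔ Γ.tail k (G ω' p) (G ω' q)) := by
    intro k hk p hp q hq
    have hp1 := hG ω p hp
    have hq1 := hG ω q hq
    have hp2 := hG ω' p (hv ▸ hp)
    have hq2 := hG ω' q (hv ▸ hq)
    rw [tail_iff_take_initial hk.le ((Γ.tail n).trans ((Γ.tail n).symm hp1.1) hq1.1),
      tail_iff_take_initial hk.le ((Γ.tail n).trans ((Γ.tail n).symm hp2.1) hq2.1),
      hp1.2, hp2.2, hq1.2, hq2.2]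
  have hψ : IsTreeCoupling ν Γ.tail n ω ω' (M.map fun p => (G ω p, G ω' p)) := by
    refine ⟨?_, ?_, fun k hk u v => ?_, fun k hk u v => ?_⟩
    · rw [Measure.map_map measurable_fst ((hGm ω).prodMk (hGm ω')), ← hM1]
      rfl
    · rw [Measure.map_map measurable_snd ((hGm ω).prodMk (hGm ω')), ← hM2]
      rfl
    · rw [← hM1]
      exact tree_condition_of_parametrization (hGm ω) (hGm ω') (measurableSet_tail k) hMA
        (fun p hp q hq => (hrel k hk p hp q hq).1) u v
    · have := tree_condition_of_parametrization (hGm ω') (hGm ω) (measurableSet_tail k) hMA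
        (fun p hp q hq => (hrel k hk p hp q hq).2) v u
      rw [show (fun p => (G ω' p, G ω p)) = Prod.swap ∘ fun p => (G ω p, G ω' p) from rfl,
        ← Measure.map_map measurable_swap ((hGm ω).prodMk (hGm ω')), map_swap_prod,
        map_swap_prod, hM2] at this
      exact this
  refine (iInf₂_le _ hψ).trans ((lintegral_map_le _ _).trans ?_)
  calc ∫⁻ p, ENNReal.ofReal (ρ (G ω p) (G ω' p)) ∂M
      ≤ ∫⁻ p, (h (G ω p) + h (G ω' p)) ∂M := by
        rw [← hM1] at hS
        rw [← hM2] at hS'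
        refine lintegral_mono_ae ?_
        filter_upwards [ae_of_ae_map (hGm ω).aemeasurable hS,
          ae_of_ae_map (hGm ω').aemeasurable hS', hMA] with p h1 h2 hp
        refine hρ _ h1 _ h2 ((initial_eq_iff _ _ n).1 ?_)
        rw [(hG ω p hp).2, (hG ω' p (hv ▸ hp)).2]
    _ = _ := by
        rw [← hM1, ← hM2, lintegral_map hh (hGm ω), lintegral_map hh (hGm ω')]
        exact lintegral_add_left (hh.comp (hGm ω)) _

end Regular

end EquippedMultigraph

/-! ### Separable semimetrics -/

/-- On the set `S`, of full measure, `ρ` is a semimetric that has a countable dense set of points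
whose distance functions are integrable. -/
structure IsSeparableSemimetricOn {X : Type*} [MeasurableSpace X] (μ : Measure X)
    (ρ : X → X → ℝ) (S : Set X) : Prop where
  ae_mem : ∀ᵐ x ∂μ, x ∈ S
  self : ∀ x ∈ S, ρ x x = 0
  symm : ∀ x ∈ S, ∀ y ∈ S, ρ x y = ρ y x
  triangle : ∀ x ∈ S, ∀ y ∈ S, ∀ z ∈ S, ρ x z ≤ ρ x y + ρ y z
  separable : ∃ Q ⊆ S, Q.Countable ∧ ∀ x ∈ S, ∀ ε > 0, ∃ q ∈ Q, ρ x q < ε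
  integrable : ∀ q ∈ S, Integrable (fun x => ρ x q) μ

theorem IsSeparableSemimetricOn.nonneg {X : Type*} [MeasurableSpace X] {μ : Measure X}
    {ρ : X → X → ℝ} {S : Set X} (h : IsSeparableSemimetricOn μ ρ S) {x y : X} (hx : x ∈ S)
    (hy : y ∈ S) : 0 ≤ ρ x y := by
  have h1 := h.triangle x hx y hy x hx
  rw [h.self x hx, h.symm y hy x hx] at h1
  linarith

theorem IsTest.exists_isSeparableSemimetricOn {X : Type*} [MeasurableSpace X] {μ : Measure X}
    [IsProbabilityMeasure μ] {t : TestKind} {ρ : X → X → ℝ} (h : IsTest μ t ρ) :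
    ∃ S, IsSeparableSemimetricOn μ ρ S := by
  cases t with
  | function =>
    obtain ⟨f, hf, rfl⟩ := h
    refine ⟨univ, ae_of_all _ mem_univ, by simp, fun x _ y _ => abs_sub_comm _ _,
      fun x _ y _ z _ => abs_sub_le _ _ _, ?_, fun q _ => ?_⟩
    · refine exists_countable_dense_of_countable_cover
        (𝒞 := range fun p : ℚ × ℚ => f ⁻¹' Ioo (p.1 : ℝ) p.2) (countable_range _)
        fun x _ ε hε => ?_
      obtain ⟨a, ha, ha'⟩ := exists_rat_btwn (show f x - ε / 2 < f x by linarith)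
      obtain ⟨b, hb, hb'⟩ := exists_rat_btwn (show f x < f x + ε / 2 by linarith)
      refine ⟨_, ⟨(a, b), rfl⟩, ⟨ha', hb⟩, fun y hy _ => ?_⟩
      have h1 : (a : ℝ) < f y := hy.1
      have h2 : f y < (b : ℝ) := hy.2
      rw [abs_lt]
      constructor <;> linarith
    · exact ((hf.integrable le_top).sub (integrable_const (f q))).abs
  | cut =>
    obtain ⟨m, c, hc, rfl⟩ := h
    refine ⟨univ, ae_of_all _ mem_univ, by simp, fun x _ y _ => by simp only [eq_comm],
      fun x _ y _ z _ => ?_, ?_, fun q _ => ?_⟩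
    · by_cases h1 : c x = c y
      · by_cases h2 : c y = c z <;> simp [h1, h2]
      · rw [if_neg h1]
        split_ifs <;> norm_num
    · refine exists_countable_dense_of_countable_cover
        (𝒞 := range fun i => c ⁻¹' {i}) (countable_range _) fun x _ ε hε => ?_
      refine ⟨_, ⟨c x, rfl⟩, rfl, fun y hy _ => ?_⟩
      rw [if_pos (show c y = c x from hy).symm]
      exact hε
    · refine Integrable.of_bound
        (((Measurable.of_discrete (f := fun i => if i = c q then (0 : ℝ) else 1)).comp_aemeasurable
          hc).aestronglyMeasurable) 1 (ae_of_all _ fun x => ?_)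
      by_cases h : c x = c q <;> simp [h]
  | metric =>
    obtain ⟨hint, S, hS, hS0, hS1, hS2, Q, hQS, hQ, hQd⟩ := h
    -- By Fubini almost every distance function is integrable; the remaining points are removed from
    -- `S`.
    refine ⟨{x | x ∈ S ∧ Integrable (fun y => ρ y x) μ}, hS.and hint.prod_left_ae,
      fun x hx => (hS0 x hx.1 x hx.1).2 rfl, fun x hx y hy => hS1 x hx.1 y hy.1,
      fun x hx y hy z hz => hS2 x hx.1 y hy.1 z hz.1, ?_, fun q hq => hq.2⟩
    refine exists_countable_dense_of_countable_cover
      (𝒞 := ⋃ q ∈ Q, range fun n : ℕ => {x | ρ x q < 1 / ((n : ℝ) + 1)})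
      (hQ.biUnion fun q _ => countable_range _) fun x hx ε hε => ?_
    obtain ⟨n, hn⟩ := exists_nat_one_div_lt (half_pos hε)
    obtain ⟨q, hq, hxq⟩ := hQd x hx.1 (1 / ((n : ℝ) + 1)) (by positivity)
    refine ⟨_, mem_biUnion hq ⟨n, rfl⟩, hxq, fun y hy hyS => ?_⟩
    have h3 := hS2 _ hx.1 _ (hQS hq) _ hyS.1
    rw [hS1 _ (hQS hq) _ hyS.1] at h3
    have h4 : ρ y q < 1 / ((n : ℝ) + 1) := hy
    linarith

/-- In a separable semimetric space, the distance to finitely many of the points of a dense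
sequence is small in the mean. -/
theorem IsSeparableSemimetricOn.exists_lintegral_lt {X : Type*} [MeasurableSpace X]
    {μ : Measure X} [IsProbabilityMeasure μ] {ρ : X → X → ℝ} {S : Set X}
    (h : IsSeparableSemimetricOn μ ρ S) {δ : ℝ≥0∞} (hδ : 0 < δ) :
    ∃ (q : ℕ → X) (K : ℕ), (∀ i, q i ∈ S) ∧
      ∫⁻ x, ⨅ i ∈ Finset.range (K + 1), ENNReal.ofReal (ρ x (q i)) ∂μ < δ := by
  obtain ⟨Q, hQS, hQ, hQd⟩ := h.separable
  obtain ⟨x₀, hx₀⟩ := h.ae_mem.exists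
  obtain ⟨q₀, hq₀, -⟩ := hQd x₀ hx₀ 1 one_pos
  obtain ⟨q, rfl⟩ := hQ.exists_eq_range ⟨q₀, hq₀⟩
  have hqS : ∀ i, q i ∈ S := fun i => hQS ⟨i, rfl⟩
  have hm : ∀ i, AEMeasurable (fun x => ENNReal.ofReal (ρ x (q i))) μ := fun i =>
    (h.integrable _ (hqS i)).aemeasurable.ennreal_ofReal
  -- The minima decrease to `0` by density. The range `K + 1` is never empty, so already the first
  -- minimum has a finite integral.
  have key := lintegral_iInf' (μ := μ)
    (f := fun K x => ⨅ i ∈ Finset.range (K + 1), ENNReal.ofReal (ρ x (q i)))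
    (fun K => AEMeasurable.biInf _ (Finset.countable_toSet _) fun i _ => hm i)
    (ae_of_all _ fun x K L hKL => biInf_mono fun i hi =>
      Finset.range_mono (Nat.succ_le_succ hKL) hi)
    (by
      refine ((lintegral_mono fun x => iInf₂_le 0 (by simp)).trans_lt ?_).ne
      exact (h.integrable _ (hqS 0)).lintegral_lt_top)
  have h0 : ∀ᵐ x ∂μ, ⨅ K : ℕ, ⨅ i ∈ Finset.range (K + 1), ENNReal.ofReal (ρ x (q i)) = 0 := by
    filter_upwards [h.ae_mem] with x hx
    refine le_antisymm (ENNReal.le_of_forall_pos_le_add fun ε hε _ => ?_) zero_le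
    obtain ⟨_, ⟨i, rfl⟩, hi⟩ := hQd x hx ε hε
    refine (iInf_le_of_le i (iInf₂_le i (by simp))).trans ?_
    rw [zero_add]
    exact ENNReal.ofReal_le_of_le_toReal hi.le
  rw [lintegral_congr_ae h0, lintegral_zero] at key
  obtain ⟨K, hK⟩ := iInf_lt_iff.1 (key ▸ hδ)
  exact ⟨q, K, hqS, hK⟩

/-! ### Approximation by initial segments and the criterion for minimal filtrations -/

namespace EquippedMultigraph

variable {Γ : EquippedMultigraph}

/-- The σ-algebra generated by the initial paths of length `n`. -/
@[reducible] def initialSigma (Γ : EquippedMultigraph) (n : ℕ) : MeasurableSpace Γ.PathSpace :=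
  MeasurableSpace.comap (initial · n) inferInstance

/-- The filtration of the path space by the initial paths. -/
def initialFiltration (Γ : EquippedMultigraph) :
    MeasureTheory.Filtration ℕ (inferInstance : MeasurableSpace Γ.PathSpace) where
  seq := Γ.initialSigma
  mono' := monotone_nat_of_le_succ fun n => by
    rintro _ ⟨U, -, rfl⟩
    exact ⟨List.tail ⁻¹' U, trivial, rfl⟩
  le' n := (measurable_initial n).comap_le

theorem iSup_initialFiltration :
    ⨆ n, Γ.initialFiltration n = (inferInstance : MeasurableSpace Γ.PathSpace) := by
  refine le_antisymm (iSup_le Γ.initialFiltration.le) ?_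
  refine Measurable.comap_le (m₁ := ⨆ n, Γ.initialFiltration n) ?_
  refine @measurable_pi_lambda _ _ _ (⨆ n, Γ.initialFiltration n) _ _ fun i U _ => ?_
  refine le_iSup (fun n => Γ.initialFiltration n) (i + 1) _
    ⟨{p | ∃ e ∈ U, ∃ q, p = e :: q}, trivial, ?_⟩
  ext ω
  simp [initial]

/-- Lévy's upward theorem in L¹: the initial segments generate the Borel structure. -/
theorem tendsto_lintegral_sub_condExp (ν : Measure Γ.PathSpace) [IsFiniteMeasure ν]
    {g : Γ.PathSpace → ℝ} (hg : Integrable g ν) :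
    Tendsto (fun n => ∫⁻ x, ‖(ν[g | Γ.initialFiltration n]) x - g x‖ₑ ∂ν) atTop (𝓝 0) := by
  have h := tendsto_eLpNorm_condExp (μ := ν) (ℱ := Γ.initialFiltration) g
  rw [iSup_initialFiltration] at h
  refine h.congr fun n => ?_
  rw [eLpNorm_one_eq_lintegral_enorm]
  refine lintegral_congr_ae ?_
  filter_upwards [condExp_of_aestronglyMeasurable' le_rfl hg.aestronglyMeasurable hg] with x hx
  rw [Pi.sub_apply, hx]

/-- The chosen version factors through the initial path, so equality holds at every pair, as needed
on the pairs of a coupling. -/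
theorem condExp_initialFiltration_congr (ν : Measure Γ.PathSpace) (g : Γ.PathSpace → ℝ) {n : ℕ}
    {x y : Γ.PathSpace} (h : ∀ i < n, x.1 i = y.1 i) :
    (ν[g | Γ.initialFiltration n]) x = (ν[g | Γ.initialFiltration n]) y :=
  (stronglyMeasurable_condExp (m := Γ.initialSigma n)).factorsThrough ((initial_eq_iff x y n).2 h)

/-- A separable semimetric on the path space is small in the mean on the pairs of paths with the
same initial segment of a large length. -/
theorem exists_bound_of_eq_initial {ν : Measure Γ.PathSpace} [IsProbabilityMeasure ν]
    {ρ : Γ.PathSpace → Γ.PathSpace → ℝ} {S : Set Γ.PathSpace}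
    (hρ : IsSeparableSemimetricOn ν ρ S) {δ : ℝ≥0∞} (hδ : 0 < δ) :
    ∃ (n : ℕ) (h : Γ.PathSpace → ℝ≥0∞) (S' : Set Γ.PathSpace), Measurable h ∧
      (∀ᵐ x ∂ν, x ∈ S') ∧ ∫⁻ x, h x ∂ν < δ ∧ ∀ x ∈ S', ∀ y ∈ S', (∀ i < n, x.1 i = y.1 i) →
        ENNReal.ofReal (ρ x y) ≤ h x + h y := by
  obtain ⟨q, K, hq, hK⟩ := hρ.exists_lintegral_lt hδ
  set I := Finset.range (K + 1)
  set m : Γ.PathSpace → ℝ≥0∞ := fun x => ⨅ i ∈ I, ENNReal.ofReal (ρ x (q i))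
  have hint : ∀ i, Integrable (fun x => ρ x (q i)) ν := fun i => hρ.integrable _ (hq i)
  set E : ℕ → ℕ → Γ.PathSpace → ℝ := fun n i => ν[fun x => ρ x (q i) | Γ.initialFiltration n]
  set b : ℕ → ℕ → Γ.PathSpace → ℝ≥0∞ := fun n i x => ‖E n i x - ρ x (q i)‖ₑ
  have hm : AEMeasurable m ν := AEMeasurable.biInf _ (Finset.countable_toSet _) fun i _ =>
    (hint i).aemeasurable.ennreal_ofReal
  have hb : ∀ n i, AEMeasurable (b n i) ν := fun n i =>
    (integrable_condExp.sub (hint i)).aestronglyMeasurable.enorm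
  have hlim : Tendsto (fun n => ∫⁻ x, (m x + 2 * ∑ i ∈ I, b n i x) ∂ν) atTop
      (𝓝 (∫⁻ x, m x ∂ν)) := by
    have h1 : Tendsto (fun n => ∫⁻ x, m x ∂ν + 2 * ∑ i ∈ I, ∫⁻ x, b n i x ∂ν) atTop
        (𝓝 (∫⁻ x, m x ∂ν + 2 * ∑ i ∈ I, 0)) :=
      tendsto_const_nhds.add (ENNReal.Tendsto.const_mul
        (tendsto_finsetSum _ fun i _ => tendsto_lintegral_sub_condExp ν (hint i))
        (Or.inr ENNReal.ofNat_ne_top))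
    simp only [Finset.sum_const_zero, mul_zero, add_zero] at h1
    refine h1.congr fun n => ?_
    rw [lintegral_add_left' hm, lintegral_const_mul' _ _ ENNReal.ofNat_ne_top,
      lintegral_finsetSum' _ fun i _ => hb n i]
  obtain ⟨n, hn⟩ := (hlim.eventually_lt_const hK).exists
  have hh : AEMeasurable (fun x => m x + 2 * ∑ i ∈ I, b n i x) ν :=
    hm.add ((Finset.aemeasurable_fun_sum _ fun i _ => hb n i).const_mul _)
  -- Minimizing the predicted instead of the true distance costs at most the errors at two indices,
  -- each bounded by the sum; hence the factor `2`.
  have hle : ∀ x ∈ S, ∀ j ∈ I, (∀ i ∈ I, E n j x ≤ E n i x) →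
      ENNReal.ofReal (ρ x (q j)) ≤ m x + 2 * ∑ i ∈ I, b n i x := by
    intro x hx j hj hmin
    refine tsub_le_iff_right.1 (le_iInf₂ fun i hi => tsub_le_iff_right.2 ?_)
    have hbs : ∀ i ∈ I, b n i x ≤ ∑ i ∈ I, b n i x := fun i hi =>
      Finset.single_le_sum (f := fun i => b n i x) (fun _ _ => zero_le) hi
    calc ENNReal.ofReal (ρ x (q j))
        ≤ ENNReal.ofReal (ρ x (q i) + (|E n i x - ρ x (q i)| + |E n j x - ρ x (q j)|)) := by
          refine ENNReal.ofReal_le_ofReal ?_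
          have h1 := le_abs_self (E n i x - ρ x (q i))
          have h2 := neg_abs_le (E n j x - ρ x (q j))
          have h3 := hmin i hi
          linarith
      _ = ENNReal.ofReal (ρ x (q i)) + (b n i x + b n j x) := by
          rw [ENNReal.ofReal_add (hρ.nonneg hx (hq i)) (by positivity),
            ENNReal.ofReal_add (abs_nonneg _) (abs_nonneg _)]
          simp only [b, Real.enorm_eq_ofReal_abs]
      _ ≤ _ := by
          rw [two_mul]
          exact add_le_add le_rfl (add_le_add (hbs i hi) (hbs j hj))
  refine ⟨n, hh.mk _, {x | x ∈ S ∧ m x + 2 * ∑ i ∈ I, b n i x = hh.mk _ x}, hh.measurable_mk,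
    hρ.ae_mem.and hh.ae_eq_mk, ?_, ?_⟩
  · rwa [← lintegral_congr_ae hh.ae_eq_mk]
  · rintro x ⟨hx, hxh⟩ y ⟨hy, hyh⟩ hxy
    rw [← hxh, ← hyh]
    -- The predictions at `x` and `y` coincide, so one index `j` is minimal for both.
    obtain ⟨j, hj, hmin⟩ := I.exists_min_image (fun i => E n i x) ⟨0, by simp [I]⟩
    have hE : ∀ i, E n i x = E n i y := fun i => condExp_initialFiltration_congr ν _ hxy
    calc ENNReal.ofReal (ρ x y) ≤ ENNReal.ofReal (ρ x (q j) + ρ y (q j)) := by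
          refine ENNReal.ofReal_le_ofReal ?_
          rw [hρ.symm y hy _ (hq j)]
          exact hρ.triangle x hx _ (hq j) y hy
      _ = ENNReal.ofReal (ρ x (q j)) + ENNReal.ofReal (ρ y (q j)) :=
          ENNReal.ofReal_add (hρ.nonneg hx (hq j)) (hρ.nonneg hy (hq j))
      _ ≤ _ := add_le_add (hle x hx j hj hmin) (hle y hy j hj fun i hi => by
          rw [← hE, ← hE]
          exact hmin i hi)

/-- Minimal filtrations satisfy the standardness criterion. -/
theorem IsMinimal.standardnessCriterion (hΓ : Γ.IsMinimal) {ν : Measure Γ.PathSpace}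
    [IsProbabilityMeasure ν] (hν : Γ.Agrees ν) (t : TestKind) :
    StandardnessCriterion t ν Γ.tail := by
  intro ρ hρ ε hε
  obtain ⟨S₀, hS₀⟩ := hρ.exists_isSeparableSemimetricOn
  -- With threshold `ε / 4` for the block averages, Markov's inequality leaves a bad set of measure
  -- at most `ε / 2`, and two good averages add up to at most `ε / 2`.
  obtain ⟨N, h, S, hh, hS, hδ, hb⟩ := exists_bound_of_eq_initial hS₀
    (show 0 < ENNReal.ofReal (ε / 4) * ENNReal.ofReal (ε / 2) by
      rw [← ENNReal.ofReal_mul (by positivity)]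
      exact ENNReal.ofReal_pos.2 (by positivity))
  refine ⟨N, fun n hn => ?_⟩
  set F : Γ.PathSpace → ℝ≥0∞ := fun ω => ∫⁻ x, h x ∂(condMeasure ν (Γ.tail n) ω)
  have hF : Measurable F := (measurable_lintegral_condMeasure ν _ hh).mono
    (partitionSigma_le _) le_rfl
  set U : Set Γ.PathSpace := {ω | ENNReal.ofReal (ε / 4) ≤ F ω}
  have hU : MeasurableSet U := measurableSet_le measurable_const hF
  set G : Set Γ.PathSpace := {ω | IsRegularPath ν n ω ∧
    (∀ᵐ x ∂(condMeasure ν (Γ.tail n) ω), x ∈ S) ∧ F ω < ENNReal.ofReal (ε / 4)}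
  have hGU : G =ᵐ[ν] Uᶜ := by
    filter_upwards [hν.ae_isRegularPath n, ae_condMeasure_ae ν (Γ.tail n) hS] with ω h1 h2
    exact propext ⟨fun h => not_le.2 h.2.2, fun h => ⟨h1, h2, not_le.1 h⟩⟩
  have hGsat : Quotient.mk (Γ.tail n) ⁻¹' (Quotient.mk (Γ.tail n) '' G) = G := by
    refine Subset.antisymm ?_ (subset_preimage_image _ _)
    rintro ω ⟨ω₀, ⟨h1, h2, h3⟩, he⟩
    have he := Quotient.exact he
    refine ⟨h1.congr he, ?_, ?_⟩
    · rwa [condMeasure_congr ν he] at h2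
    · simp only [F] at h3 ⊢
      rwa [condMeasure_congr ν he] at h3
  have hUε : ν.real U ≤ ε / 2 := by
    have h1 := mul_meas_ge_le_lintegral (μ := ν) hF (ENNReal.ofReal (ε / 4))
    rw [lintegral_lintegral_condMeasure ν _ hh] at h1
    have h2 := (ENNReal.mul_lt_mul_iff_right (ENNReal.ofReal_pos.2 (by positivity)).ne'
      ENNReal.ofReal_ne_top).1 (h1.trans_lt hδ)
    exact ENNReal.toReal_le_of_le_ofReal (by positivity) h2.le
  refine ⟨Quotient.mk (Γ.tail n) '' G, ?_, ?_, ε / 2, by linarith, fun ω ω' hω hω' hs => ?_⟩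
  · rw [hGsat]
    exact hU.compl.nullMeasurableSet.congr hGU.symm
  · have hG : ν.real G = 1 - ν.real U :=
      (measureReal_congr hGU).trans (probReal_compl_eq_one_sub hU)
    rw [hGsat, hG]
    linarith
  · have hω : ω ∈ G := hGsat ▸ hω
    have hω' : ω' ∈ G := hGsat ▸ hω'
    -- The one function `h` serves all `n > N`, since agreement on `n` edges implies agreement on
    -- `N`.
    refine (hω.1.treeDist_le hω'.1 (hΓ.vertex_eq_of_sameType hω.1 hω'.1 hs) hh hω.2.1 hω'.2.1
      fun x hx y hy hxy => hb x hx y hy fun i hi => hxy i (hi.trans hn)).trans ?_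
    rw [show ε / 2 = ε / 4 + ε / 4 by ring, ENNReal.ofReal_add (by positivity) (by positivity)]
    exact add_le_add hω.2.2.le hω'.2.2.le

end EquippedMultigraph

end Filtrations

end

/-! ### The proposition -/

open Filtrations in
theorem proposition5 (t : TestKind) :
    (∀ (X Y : Type*) [MeasurableSpace X] [StandardBorelSpace X]
        [MeasurableSpace Y] [StandardBorelSpace Y]
        (μ : Measure X) [IsProbabilityMeasure μ] [NullSingletonClass μ]
        (ν : Measure Y) [IsProbabilityMeasure ν] [NullSingletonClass ν]
        (ξ : ℕ → Setoid X) (ζ : ℕ → Setoid Y),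
        IsLocallyFiniteFiltration μ ξ → IsLocallyFiniteFiltration ν ζ →
        IsomorphicFiltrations μ ξ ν ζ →
        StandardnessCriterion t μ ξ → StandardnessCriterion t ν ζ) ∧
    (∀ (Γ : EquippedMultigraph) (ν : Measure Γ.PathSpace) [IsProbabilityMeasure ν],
        Γ.IsMinimal → Γ.Agrees ν → StandardnessCriterion t ν Γ.tail) ∧
    (∀ (X : Type*) [MeasurableSpace X] [StandardBorelSpace X]
        (μ : Measure X) [IsProbabilityMeasure μ] [NullSingletonClass μ] (ξ : ℕ → Setoid X),
        IsStandard μ ξ → StandardnessCriterion t μ ξ) := by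
  refine ⟨?_, ?_, ?_⟩
  · intro X Y _ _ _ _ μ _ _ ν _ _ ξ ζ hξ hζ h hμ
    exact hμ.of_iso hξ.measurable_partition hζ.measurable_partition h
  · intro Γ ν _ hΓ hν
    exact hΓ.standardnessCriterion hν t
  · rintro X _ _ μ _ _ ξ ⟨hξ, -, Γ, ν, hν, hΓ, hA, h⟩
    exact (hΓ.standardnessCriterion hA t).of_iso Γ.exists_tail_eq_ker hξ.measurable_partition
      h.symm
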